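/- **Theorem 1 (Bayesian simple hypothesis testing).** Let $p$ and $q$ be two probability distributions on a countable set $\mathcal X$, with masses $p_i,q_i$ for $i\in\mathcal X$. For $\alpha,\delta\in(0,1)$ let $n^*_{\mathrm B}(p,q,\alpha,\delta)\in\{0,1,2,\dots\}\cup\{\infty\}$ be the smallest $n$ for which there is a test $\phi:\mathcal X^n\to\{p,q\}$ (the outputs being the labels of the two hypotheses) with $$\alpha\,\mathbb P_{X\sim p^{\otimes n}}\{\phi(X)\neq p\}+(1-\alpha)\,\mathbb P_{X\sim q^{\otimes n}}\{\phi(X)\neq q\}\le\delta,$$ and $\infty$ if there is no such $n$. Let $\mathrm h^2(p,q)=\tfrac12\sum_i(\sqrt{p_i}-\sqrt{q_i})^2$ be the Hellinger divergence, let $\mathcal H_{s}(p,q)=1-\sum_i p_i^{s}q_i^{1-s}$ for $s\in(0,1)$, and let $I(\Theta;X_1)$ be the mutual information of the pair $(\Theta,X_1)$ in which $\Theta$ is $p$ with probability $\alpha$ and $q$ with probability $1-\alpha$, and $X_1\sim\theta$ given $\Theta=\theta$. Logarithms are natural; $x/0=\infty$ for $x>0$; and $a\asymp b$ means that $a\le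 Cb$ and $b\le Ca$ for a constant $C\in(0,\infty)$ that is absolute, i.e. independent of $\mathcal X,p,q,\alpha,\delta$. Assume $\mathrm h^2(p,q)\le 0.125$, $\alpha\in(0,1/2]$ and $0<\delta\le\alpha/4$. 1. (Linear error probability) If $\delta\in[\alpha/100,\alpha/4]$, then for $\lambda=\dfrac{0.5\log 2}{\log(1/\alpha)}$, $$n^*_{\mathrm B}(p,q,\alpha,\delta)\asymp\frac{\alpha\log(1/\alpha)}{I(\Theta;X_1)}\asymp\frac1{\mathcal H_{1-\lambda}(p,q)}.$$ 2. (Sublinear error probability) If $\delta\in[\alpha^2,\alpha/100]$, then for $T=\left\lfloor\dfrac{\log(\alpha/\delta)}{\log 8}\right\rfloor$ and $\alpha'=\alpha^{1/T}$, $$n^*_{\mathrm B}(p,q,\alpha,\delta)\asymp\log(\alpha/\delta)\cdot n^*_{\mathrm B}(p,q,\alpha',\alpha'/4).$$ 3. (Polynomial error probability) If $\delta\le\alpha^2$, then $$n^*_{\mathrm B}(p,q,\alpha,\delta)\asymp\frac{\log(1/\delta)}{\mathrm h^2(p,q)}.$$ -/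

import Mathlib

open MeasureTheory
open scoped ENNReal NNReal

noncomputable section

namespace HypothesisTesting

/-! Discrete distributions are probability measures on a countable space in which singletons are
measurable. The two hypotheses are the labels `true` (the samples come from `p`) and `false`
(the samples come from `q`). -/

/-- The average error probability, under the prior `(α, 1 - α)`, of a test `φ` that sees `n`
i.i.d. samples: `α · P_{X ∼ p^{⊗n}}(φ(X) ≠ p) + (1 - α) · P_{X ∼ q^{⊗n}}(φ(X) ≠ q)`. -/
def bayesError {𝒳 : Type*} [MeasurableSpace 𝒳] (p q : Measure 𝒳) (α : ℝ) {n : ℕ}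
    (φ : (Fin n → 𝒳) → Bool) : ℝ :=
  α * (Measure.pi (fun _ : Fin n => p)).real {x | φ x ≠ true} +
    (1 - α) * (Measure.pi (fun _ : Fin n => q)).real {x | φ x ≠ false}

/-- Some test on `n` samples solves the Bayesian simple binary hypothesis testing problem of `p`
versus `q` under the prior `(α, 1 - α)` with probability of error `δ`. -/
def SolvableWith {𝒳 : Type*} [MeasurableSpace 𝒳] (p q : Measure 𝒳) (α δ : ℝ) (n : ℕ) : Prop :=
  ∃ φ : (Fin n → 𝒳) → Bool, bayesError p q α φ ≤ δ

/-- The Bayesian sample complexity: the smallest `n` for which some test on `n` samples solves the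
problem (`⊤` if there is no such `n`). -/
def sampleComplexity {𝒳 : Type*} [MeasurableSpace 𝒳] (p q : Measure 𝒳) (α δ : ℝ) : ℕ∞ :=
  ⨅ (n : ℕ) (_ : SolvableWith p q α δ n), (n : ℕ∞)

/-- The Hellinger divergence `h²(p, q) = (1/2) ∑ᵢ (√pᵢ - √qᵢ)²`. -/
def hellingerSq {𝒳 : Type*} [MeasurableSpace 𝒳] (p q : Measure 𝒳) : ℝ :=
  (1 / 2) * ∑' i : 𝒳, (√(p.real {i}) - √(q.real {i})) ^ 2

/-- The divergence `H_s(p, q) = 1 - ∑ᵢ pᵢ ^ s qᵢ ^ (1 - s)`, for `s ∈ (0, 1)`. -/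
def hellingerDiv {𝒳 : Type*} [MeasurableSpace 𝒳] (s : ℝ) (p q : Measure 𝒳) : ℝ :=
  1 - ∑' i : 𝒳, (p.real {i}) ^ s * (q.real {i}) ^ (1 - s)

/-- The mutual information (in nats) of two random variables: the Kullback–Leibler divergence of
their joint law from the product of their laws. -/
def mutualInfo {Ω A B : Type*} [MeasurableSpace Ω] [MeasurableSpace A] [MeasurableSpace B]
    (X : Ω → A) (Y : Ω → B) (μ : Measure Ω) : ℝ≥0∞ :=
  InformationTheory.klDiv (μ.map (fun ω => (X ω, Y ω))) ((μ.map X).prod (μ.map Y))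

/-- The joint law of `(Θ, X₁)`: `Θ` is `p` with probability `α` and `q` with probability `1 - α`,
and `X₁` has law `θ` conditionally on `Θ = θ`. -/
def jointLaw {𝒳 : Type*} [MeasurableSpace 𝒳] (α : ℝ) (p q : Measure 𝒳) : Measure (Bool × 𝒳) :=
  ENNReal.ofReal α • (Measure.dirac true).prod p +
    ENNReal.ofReal (1 - α) • (Measure.dirac false).prod q

/-- `I(Θ; X₁)`. -/
def infoPerSample {𝒳 : Type*} [MeasurableSpace 𝒳] (α : ℝ) (p q : Measure 𝒳) : ℝ≥0∞ :=
  mutualInfo (Prod.fst : Bool × 𝒳 → Bool) (Prod.snd : Bool × 𝒳 → 𝒳) (jointLaw α p q)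

/-- `a` and `b` agree up to the multiplicative constant `C`. -/
def EqUpTo (C : ℝ≥0) (a b : ℝ≥0∞) : Prop :=
  a ≤ C * b ∧ b ≤ C * a

end HypothesisTesting

end

open HypothesisTesting

namespace HypothesisTesting

/-! The least weighted error on `n` samples is the sum over the product space of `min (α ∏ pᵢ) ((1 -
α) ∏ qᵢ)`, so every claim concerns how this sum behaves under products. The recursion `optError`
computes it one sample at a time, and `solvableWith_iff` says that solvability means `optError ≤ δ`.

Upper bounds on the sample size are Chernoff bounds: `min a b ≤ a ^ s * b ^ (1 - s)` tensorizes to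
an error at most `α ^ s * exp (-n * H_s)`. For lower bounds, an inequality `a ^ s * b ^ (1 - s) ≤ A
* a + B * b + K * min a b` also tensorizes (`affinity_pow_mul_le`), since the linear terms keep
their total mass. Taking `s = 1/2` gives `α (1 - α) (1 - h²) ^ (2 n) ≤ δ`, hence the polynomial
regime. Taking `s = 1 - l`, with Young's inequality tangent at the prior ratio, shows that `n *
H_{1-l}` is bounded below once the error is at most `α / 4`. The choice of `l` makes `α ^ (-l) =
√2`, so in the linear regime the Chernoff bound at `1 - l` loses only a constant.

The mutual information and `H_{1-l}` are both `f`-divergences, and `infoGen_le` and `le_infoGen`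
compare their generators pointwise: both are quadratic on `[0, 1]`, and beyond `1` both derivatives
behave like `min (log t) (log (1 / α))` after scaling.

In the sublinear regime the sample is cut into `T` blocks. Since `min a b * min c d ≤ min (a * c) (b
* d)`, the error on `k * T` samples with prior `α' ^ T` is at least the `T`-th power of the error on
`k` samples with prior `α'` (`SolvableWith.of_pow`). Conversely, the linear-regime lower bound at
`α'` controls `1 / H_{1-l}`, and the Chernoff bound with the same `l` solves the original problem.
-/

/-- The least value of `a · P(error | p) + b · P(error | q)` over the tests that see `n` samples,
for mass functions `p` and `q`, by recursion on the first sample. -/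
noncomputable def optError {𝒳 : Type*} (p q : 𝒳 → ℝ≥0∞) : ℕ → ℝ≥0∞ → ℝ≥0∞ → ℝ≥0∞
  | 0, a, b => min a b
  | n + 1, a, b => ∑' i, optError p q n (a * p i) (b * q i)

/-- The affinity `∑ᵢ pᵢ ^ s qᵢ ^ (1 - s)` of two mass functions. -/
noncomputable def affinity {𝒳 : Type*} (s : ℝ) (p q : 𝒳 → ℝ≥0∞) : ℝ≥0∞ :=
  ∑' i, p i ^ s * q i ^ (1 - s)

/-! ### Tensorization of the minimal error and of affinities. -/

section optError

variable {𝒳 : Type*} {p q : 𝒳 → ℝ≥0∞}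

lemma optError_mono (n : ℕ) {a a' b b' : ℝ≥0∞} (ha : a ≤ a') (hb : b ≤ b') :
    optError p q n a b ≤ optError p q n a' b' := by
  induction n generalizing a a' b b' with
  | zero => exact min_le_min ha hb
  | succ n ih => exact ENNReal.tsum_le_tsum fun i => ih (by gcongr) (by gcongr)

lemma mul_optError_le (n : ℕ) (c a b : ℝ≥0∞) :
    c * optError p q n a b ≤ optError p q n (c * a) (c * b) := by
  induction n generalizing a b with
  | zero =>
    exact le_min (mul_le_mul_right (min_le_left _ _) _) (mul_le_mul_right (min_le_right _ _) _)
  | succ n ih =>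
    simp only [optError, ← ENNReal.tsum_mul_left]
    refine ENNReal.tsum_le_tsum fun i => ?_
    simpa only [mul_assoc] using ih (a * p i) (b * q i)

lemma optError_succ_le (hp : ∑' i, p i = 1) (hq : ∑' i, q i = 1) (n : ℕ) (a b : ℝ≥0∞) :
    optError p q (n + 1) a b ≤ optError p q n a b := by
  induction n generalizing a b with
  | zero =>
    refine le_min ?_ ?_
    · calc optError p q 1 a b ≤ ∑' i, a * p i := ENNReal.tsum_le_tsum fun i => min_le_left _ _
        _ = a := by rw [ENNReal.tsum_mul_left, hp, mul_one]
    · calc optError p q 1 a b ≤ ∑' i, b * q i := ENNReal.tsum_le_tsum fun i => min_le_right _ _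
        _ = b := by rw [ENNReal.tsum_mul_left, hq, mul_one]
  | succ n ih => exact ENNReal.tsum_le_tsum fun i => ih _ _

lemma optError_antitone (hp : ∑' i, p i = 1) (hq : ∑' i, q i = 1) (a b : ℝ≥0∞) :
    Antitone fun n => optError p q n a b :=
  antitone_nat_of_succ_le fun n => optError_succ_le hp hq n a b

/-- Independent batches: `min a b * min c d ≤ min (a * c) (b * d)`, summed over both batches. -/
lemma optError_mul_le (k l : ℕ) (a b c d : ℝ≥0∞) :
    optError p q k a b * optError p q l c d ≤ optError p q (k + l) (a * c) (b * d) := by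
  induction k generalizing a b with
  | zero =>
    rw [Nat.zero_add]
    refine (mul_optError_le l (min a b) c d).trans (optError_mono l ?_ ?_)
    · exact mul_le_mul_left (min_le_left _ _) _
    · exact mul_le_mul_left (min_le_right _ _) _
  | succ k ih =>
    rw [Nat.add_right_comm]
    simp only [optError, ← ENNReal.tsum_mul_right]
    refine ENNReal.tsum_le_tsum fun i => (ih _ _).trans_eq ?_
    rw [mul_right_comm a, mul_right_comm b]

lemma optError_pow_le (k T : ℕ) (a b : ℝ≥0∞) :
    optError p q k a b ^ T ≤ optError p q (k * T) (a ^ T) (b ^ T) := by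
  induction T with
  | zero => simp [optError]
  | succ T ih =>
    rw [pow_succ, pow_succ, pow_succ, Nat.mul_succ]
    exact (mul_le_mul_left ih _).trans (optError_mul_le _ _ _ _ _ _)

/-- Chernoff's bound: the minimum is at most any weighted geometric mean, and the geometric mean of
products factorizes. -/
lemma optError_le_affinity_pow {s : ℝ} (hs0 : 0 ≤ s) (hs1 : s ≤ 1) (n : ℕ) (a b : ℝ≥0∞) :
    optError p q n a b ≤ a ^ s * b ^ (1 - s) * affinity s p q ^ n := by
  have hs2 : 0 ≤ 1 - s := sub_nonneg.2 hs1
  induction n generalizing a b with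
  | zero =>
    rw [pow_zero, mul_one]
    calc min a b = min a b ^ s * min a b ^ (1 - s) := by
          rw [← ENNReal.rpow_add_of_nonneg _ _ hs0 hs2, add_sub_cancel, ENNReal.rpow_one]
      _ ≤ _ := mul_le_mul' (ENNReal.rpow_le_rpow (min_le_left _ _) hs0)
          (ENNReal.rpow_le_rpow (min_le_right _ _) hs2)
  | succ n ih =>
    refine (ENNReal.tsum_le_tsum fun i => ih (a * p i) (b * q i)).trans_eq ?_
    rw [pow_succ', affinity, ← mul_assoc, ← ENNReal.tsum_mul_left, ← ENNReal.tsum_mul_right]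
    refine tsum_congr fun i => ?_
    rw [ENNReal.mul_rpow_of_nonneg _ _ hs0, ENNReal.mul_rpow_of_nonneg _ _ hs2]
    ring

/-- A bound of a geometric mean by a linear combination of the two variables and their minimum
tensorizes. -/
lemma affinity_pow_mul_le (hp : ∑' i, p i = 1) (hq : ∑' i, q i = 1) {s : ℝ} (hs0 : 0 ≤ s)
    (hs1 : s ≤ 1) {A B K : ℝ≥0∞}
    (H : ∀ a b : ℝ≥0∞, a ≠ ⊤ → b ≠ ⊤ → a ^ s * b ^ (1 - s) ≤ A * a + B * b + K * min a b)
    (n : ℕ) {a b : ℝ≥0∞} (ha : a ≠ ⊤) (hb : b ≠ ⊤) :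
    affinity s p q ^ n * (a ^ s * b ^ (1 - s)) ≤ A * a + B * b + K * optError p q n a b := by
  have hs2 : 0 ≤ 1 - s := sub_nonneg.2 hs1
  have hp1 : ∀ i, p i ≠ ⊤ := fun i =>
    ((ENNReal.le_tsum i).trans_eq hp).trans_lt ENNReal.one_lt_top |>.ne
  have hq1 : ∀ i, q i ≠ ⊤ := fun i =>
    ((ENNReal.le_tsum i).trans_eq hq).trans_lt ENNReal.one_lt_top |>.ne
  induction n generalizing a b with
  | zero => simpa [optError] using H a b ha hb
  | succ n ih =>
    -- The first sample is absorbed into the weights. The linear terms sum back to `A * a + B * b`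
    -- because `p` and `q` have total mass one.
    calc affinity s p q ^ (n + 1) * (a ^ s * b ^ (1 - s))
        = ∑' i, affinity s p q ^ n * ((a * p i) ^ s * (b * q i) ^ (1 - s)) := by
          rw [ENNReal.tsum_mul_left, pow_succ, mul_assoc]
          congr 1
          rw [affinity, ← ENNReal.tsum_mul_right]
          refine tsum_congr fun i => ?_
          rw [ENNReal.mul_rpow_of_nonneg _ _ hs0, ENNReal.mul_rpow_of_nonneg _ _ hs2]
          ring
      _ ≤ ∑' i, (A * (a * p i) + B * (b * q i) + K * optError p q n (a * p i) (b * q i)) :=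
          ENNReal.tsum_le_tsum fun i =>
            ih (ENNReal.mul_ne_top ha (hp1 i)) (ENNReal.mul_ne_top hb (hq1 i))
      _ = A * a + B * b + K * optError p q (n + 1) a b := by
          rw [ENNReal.tsum_add, ENNReal.tsum_add]
          simp only [ENNReal.tsum_mul_left, hp, hq, mul_one, optError]

/-- The real form of `affinity_pow_mul_le`. -/
lemma toReal_affinity_pow_mul_le (hp : ∑' i, p i = 1) (hq : ∑' i, q i = 1) {s : ℝ} (hs0 : 0 ≤ s)
    (hs1 : s ≤ 1) {A B K : ℝ} (hA : 0 ≤ A) (hB : 0 ≤ B) (hK : 0 ≤ K)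
    (H : ∀ a b : ℝ, 0 ≤ a → 0 ≤ b → a ^ s * b ^ (1 - s) ≤ A * a + B * b + K * min a b)
    {n : ℕ} {a b δ : ℝ} (ha : 0 ≤ a) (hb : 0 ≤ b) (hδ : 0 ≤ δ)
    (h : optError p q n (.ofReal a) (.ofReal b) ≤ .ofReal δ) :
    (affinity s p q).toReal ^ n * (a ^ s * b ^ (1 - s)) ≤ A * a + B * b + K * δ := by
  have hs2 : 0 ≤ 1 - s := sub_nonneg.2 hs1
  have key := affinity_pow_mul_le (A := .ofReal A) (B := .ofReal B) (K := .ofReal K) hp hq hs0 hs1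
    (fun x y hx hy => by
      lift x to ℝ≥0 using hx
      lift y to ℝ≥0 using hy
      have := ENNReal.ofReal_le_ofReal (H x y x.coe_nonneg y.coe_nonneg)
      rwa [ENNReal.ofReal_add (by positivity) (by positivity),
        ENNReal.ofReal_add (by positivity) (by positivity), ENNReal.ofReal_mul hA,
        ENNReal.ofReal_mul hB, ENNReal.ofReal_mul hK, ENNReal.ofReal_mul (by positivity),
        ← ENNReal.ofReal_rpow_of_nonneg x.coe_nonneg hs0,
        ← ENNReal.ofReal_rpow_of_nonneg y.coe_nonneg hs2,
        ← NNReal.coe_min, ENNReal.ofReal_coe_nnreal, ENNReal.ofReal_coe_nnreal,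
        ENNReal.ofReal_coe_nnreal, ENNReal.coe_min] at this)
    n (ENNReal.ofReal_ne_top (r := a)) (ENNReal.ofReal_ne_top (r := b))
  have key2 := key.trans (add_le_add_right (mul_le_mul_right h _) _)
  have := ENNReal.toReal_mono (by finiteness) key2
  rwa [ENNReal.toReal_mul, ENNReal.toReal_mul, ENNReal.toReal_pow, ← ENNReal.toReal_rpow,
    ← ENNReal.toReal_rpow, ENNReal.toReal_add (by finiteness) (by finiteness),
    ENNReal.toReal_add (by finiteness) (by finiteness), ENNReal.toReal_mul, ENNReal.toReal_mul,
    ENNReal.toReal_mul, ENNReal.toReal_ofReal ha, ENNReal.toReal_ofReal hb,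
    ENNReal.toReal_ofReal hA, ENNReal.toReal_ofReal hB, ENNReal.toReal_ofReal hK,
    ENNReal.toReal_ofReal hδ] at this

lemma optError_eq_tsum (n : ℕ) (a b : ℝ≥0∞) :
    optError p q n a b =
      ∑' x : Fin n → 𝒳, min (a * ∏ j, p (x j)) (b * ∏ j, q (x j)) := by
  induction n generalizing a b with
  | zero => simp [optError]
  | succ n ih =>
    rw [← (Fin.consEquiv fun _ : Fin (n + 1) => 𝒳).tsum_eq]
    simp only [Fin.consEquiv_apply, Fin.prod_univ_succ, Fin.cons_zero, Fin.cons_succ]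
    rw [ENNReal.tsum_prod (f := fun i (x : Fin n → 𝒳) =>
      min (a * (p i * ∏ j, p (x j))) (b * (q i * ∏ j, q (x j))))]
    simp only [optError, ih, mul_assoc]

end optError

/-! ### Tests and the minimal error. -/

section SolvableWith

variable {𝒳 : Type*} [Countable 𝒳] [MeasurableSpace 𝒳] [MeasurableSingletonClass 𝒳]
  (p q : Measure 𝒳) [IsProbabilityMeasure p] [IsProbabilityMeasure q]

lemma tsum_singleton_eq_one : ∑' i, p {i} = 1 := by
  rw [← measure_univ (μ := p), ← Measure.tsum_indicator_apply_singleton p _ MeasurableSet.univ]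
  simp

lemma ofReal_bayesError {α : ℝ} (h0 : 0 ≤ α) (h1 : α ≤ 1) {n : ℕ} (φ : (Fin n → 𝒳) → Bool) :
    ENNReal.ofReal (bayesError p q α φ) =
      ∑' x : Fin n → 𝒳, bif φ x then .ofReal (1 - α) * ∏ j, q {x j}
        else .ofReal α * ∏ j, p {x j} := by
  have h2 : 0 ≤ 1 - α := sub_nonneg.2 h1
  rw [bayesError, ENNReal.ofReal_add (by positivity) (by positivity), ENNReal.ofReal_mul h0,
    ENNReal.ofReal_mul h2, ofReal_measureReal, ofReal_measureReal,
    ← Measure.tsum_indicator_apply_singleton _ _ (Set.to_countable _).measurableSet,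
    ← Measure.tsum_indicator_apply_singleton _ _ (Set.to_countable _).measurableSet,
    ← ENNReal.tsum_mul_left, ← ENNReal.tsum_mul_left, ← ENNReal.tsum_add]
  refine tsum_congr fun x => ?_
  cases h : φ x <;> simp [Set.indicator, h, Measure.pi_singleton]

lemma solvableWith_iff {α δ : ℝ} (h0 : 0 ≤ α) (h1 : α ≤ 1) (hδ : 0 ≤ δ) (n : ℕ) :
    SolvableWith p q α δ n ↔
      optError (fun i => p {i}) (fun i => q {i}) n (.ofReal α) (.ofReal (1 - α)) ≤ .ofReal δ := by
  rw [optError_eq_tsum]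
  constructor
  · rintro ⟨φ, hφ⟩
    refine le_trans ?_ (ENNReal.ofReal_le_ofReal hφ)
    rw [ofReal_bayesError p q h0 h1]
    refine ENNReal.tsum_le_tsum fun x => ?_
    cases φ x
    · exact min_le_left _ _
    · exact min_le_right _ _
  · intro h
    -- The likelihood-ratio test attains the minimum at every sample; ties go to `p`.
    refine ⟨fun x => decide (ENNReal.ofReal (1 - α) * ∏ j, q {x j} ≤
      .ofReal α * ∏ j, p {x j}), (ENNReal.ofReal_le_ofReal_iff hδ).1 ?_⟩
    rw [ofReal_bayesError p q h0 h1]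
    refine le_trans (ENNReal.tsum_le_tsum fun x => ?_) h
    by_cases hx : ENNReal.ofReal (1 - α) * ∏ j, q {x j} ≤ .ofReal α * ∏ j, p {x j}
    · simp [hx]
    · simp [hx, le_of_not_ge hx]

end SolvableWith

/-! ### The sample complexity as an infimum that is attained when finite. -/

section sampleComplexity

variable {𝒳 : Type*} [MeasurableSpace 𝒳] {p q : Measure 𝒳}

lemma sampleComplexity_le {α δ : ℝ} {n : ℕ} (h : SolvableWith p q α δ n) :
    sampleComplexity p q α δ ≤ n :=
  iInf₂_le n h

lemma exists_solvableWith_of_ne_top {α δ : ℝ} (h : sampleComplexity p q α δ ≠ ⊤) :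
    ∃ n : ℕ, sampleComplexity p q α δ = n ∧ SolvableWith p q α δ n := by
  by_cases hn : ∃ n, SolvableWith p q α δ n
  · classical
    refine ⟨Nat.find hn, le_antisymm (sampleComplexity_le (Nat.find_spec hn)) ?_, Nat.find_spec hn⟩
    exact le_iInf₂ fun m hm => by exact_mod_cast Nat.find_min' hn hm
  · exact absurd (iInf₂_eq_top.2 fun n h' => absurd ⟨n, h'⟩ hn) h

/-- A lower bound of every sample size that solves the problem bounds the sample complexity. -/
lemma le_mul_sampleComplexity {α δ : ℝ} {C : ℝ≥0} (hC : 0 < C) {x : ℝ≥0∞}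
    (h : ∀ n : ℕ, SolvableWith p q α δ n → x ≤ C * n) :
    x ≤ C * (sampleComplexity p q α δ : ℝ≥0∞) := by
  by_cases ht : sampleComplexity p q α δ = ⊤
  · rw [ht, ENat.toENNReal_top, ENNReal.mul_top (by exact_mod_cast hC.ne')]
    exact le_top
  · obtain ⟨n, hn, hs⟩ := exists_solvableWith_of_ne_top ht
    rw [hn, ENat.toENNReal_coe]
    exact h n hs

end sampleComplexity

/-! ### Comparison of the generators of mutual information and of `H_{1-l}`. -/

section Generators

/-- The generator of the mutual information `I(Θ; X₁)` as an `f`-divergence. -/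
noncomputable def infoGen (α t : ℝ) : ℝ :=
  α * (t * Real.log t) - (α * t + 1 - α) * Real.log (α * t + 1 - α)

/-- The generator of the divergence `H_{1-l}` as an `f`-divergence. -/
noncomputable def hellingerGen (l t : ℝ) : ℝ := (1 - l) * t + l - t ^ (1 - l)

variable {α l t : ℝ}

lemma mix_pos (hα0 : 0 < α) (hα1 : α < 1) (ht : 0 ≤ t) : 0 < α * t + 1 - α := by
  nlinarith [mul_nonneg hα0.le ht]

lemma hasDerivAt_infoGen (hα0 : 0 < α) (hα1 : α < 1) (ht : 0 < t) :
    HasDerivAt (infoGen α) (α * (Real.log t - Real.log (α * t + 1 - α))) t := by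
  have hm := mix_pos hα0 hα1 ht.le
  have h1 : HasDerivAt (fun t : ℝ => α * t + 1 - α) α t := by
    simpa using (((hasDerivAt_id t).const_mul α).add_const 1).sub_const α
  have h2 := (Real.hasDerivAt_mul_log hm.ne').comp t h1
  have h3 := ((Real.hasDerivAt_mul_log ht.ne').const_mul α).sub h2
  refine h3.congr_deriv ?_
  ring

lemma continuous_infoGen : Continuous (infoGen α) := by
  have h : Continuous fun t : ℝ => α * t + 1 - α := by fun_prop
  exact (Real.continuous_mul_log.const_smul α).sub (Real.continuous_mul_log.comp h)

lemma hasDerivAt_hellingerGen (ht : 0 < t) :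
    HasDerivAt (hellingerGen l) ((1 - l) * (1 - t ^ (-l))) t := by
  have h1 := (((hasDerivAt_id t).const_mul (1 - l)).add_const l).sub
    (Real.hasDerivAt_rpow_const (p := 1 - l) (Or.inl ht.ne'))
  refine h1.congr_deriv ?_
  rw [show 1 - l - 1 = -l by ring]
  ring

lemma continuous_hellingerGen (hl : l ≤ 1) : Continuous (hellingerGen l) := by
  have h := Real.continuous_rpow_const (sub_nonneg.2 hl)
  unfold hellingerGen
  fun_prop

lemma infoGen_one : infoGen α 1 = 0 := by simp [infoGen]

lemma hellingerGen_one : hellingerGen l 1 = 0 := by simp [hellingerGen]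

/-- Apply `log t ≤ t - 1` to the first term and `m log m ≥ m - 1` to the mixture `m`. -/
lemma infoGen_le_sq (hα0 : 0 < α) (hα1 : α < 1) (ht0 : 0 ≤ t) (ht1 : t ≤ 1) :
    infoGen α t ≤ α * (1 - t) ^ 2 := by
  have hm := mix_pos hα0 hα1 ht0
  have h1 : t * Real.log t ≤ t * (t - 1) := by
    rcases ht0.eq_or_lt with rfl | h
    · simp
    · exact mul_le_mul_of_nonneg_left (Real.log_le_sub_one_of_pos h) ht0
  have h2 : (α * t + 1 - α) - 1 ≤ (α * t + 1 - α) * Real.log (α * t + 1 - α) := by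
    have := mul_le_mul_of_nonneg_left (Real.one_sub_inv_le_log_of_pos hm) hm.le
    rwa [mul_sub, mul_inv_cancel₀ hm.ne', mul_one] at this
  have h3 := mul_le_mul_of_nonneg_left h1 hα0.le
  rw [infoGen]
  nlinarith

/-- A function that decreases to a zero at the right end of `[0, 1]` is nonnegative there. -/
lemma nonneg_of_deriv_nonpos_of_one {f f' : ℝ → ℝ} (hf : Continuous f)
    (hf' : ∀ x, 0 < x → HasDerivAt f (f' x) x) (h : ∀ x, 0 < x → x < 1 → f' x ≤ 0) (h1 : f 1 = 0)
    (ht0 : 0 ≤ t) (ht1 : t ≤ 1) : 0 ≤ f t := by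
  have := antitoneOn_of_deriv_nonpos (convex_Icc 0 1) hf.continuousOn
    (fun x hx => ((hf' x (by simp at hx; exact hx.1)).differentiableAt.differentiableWithinAt))
    (fun x hx => by
      simp only [interior_Icc, Set.mem_Ioo] at hx
      rw [(hf' x hx.1).deriv]
      exact h x hx.1 hx.2)
  exact h1 ▸ this ⟨ht0, ht1⟩ ⟨zero_le_one, le_rfl⟩ ht1

/-- A function that increases from a zero at `1` is nonnegative on `[1, ∞)`. -/
lemma nonneg_of_deriv_nonneg_of_one {f f' : ℝ → ℝ} (hf : Continuous f)
    (hf' : ∀ x, 0 < x → HasDerivAt f (f' x) x) (h : ∀ x, 1 < x → 0 ≤ f' x) (h1 : f 1 = 0)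
    (ht : 1 ≤ t) : 0 ≤ f t := by
  have h0 : ∀ x, x ∈ interior (Set.Ici (1 : ℝ)) → 1 < x := fun x hx => by simpa using hx
  have := monotoneOn_of_deriv_nonneg (convex_Ici 1) hf.continuousOn
    (fun x hx => ((hf' x (by linarith [h0 x hx])).differentiableAt.differentiableWithinAt))
    (fun x hx => by
      rw [(hf' x (by linarith [h0 x hx])).deriv]
      exact h x (h0 x hx))
  exact h1 ▸ this (Set.mem_Ici.2 le_rfl) ht ht

lemma hasDerivAt_mul_one_sub_sq (c x : ℝ) :
    HasDerivAt (fun t : ℝ => c * (1 - t) ^ 2) (c * (2 * (x - 1))) x := by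
  have := (((hasDerivAt_id x).const_sub 1).pow 2).const_mul c
  refine this.congr_deriv ?_
  simp
  ring

lemma sq_le_infoGen (hα0 : 0 < α) (hα1 : α ≤ 1 / 2) (ht0 : 0 ≤ t) (ht1 : t ≤ 1) :
    α / 4 * (1 - t) ^ 2 ≤ infoGen α t := by
  have hα2 : α < 1 := by linarith
  refine sub_nonneg.1 (nonneg_of_deriv_nonpos_of_one
    (f := fun t => infoGen α t - α / 4 * (1 - t) ^ 2)
    (continuous_infoGen.sub (by fun_prop))
    (fun x hx => (hasDerivAt_infoGen hα0 hα2 hx).sub (hasDerivAt_mul_one_sub_sq _ x))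
    (fun x hx0 hx1 => ?_) (by simp [infoGen_one]) ht0 ht1)
  have hm := mix_pos hα0 hα2 hx0.le
  have hm1 : α * x + 1 - α ≤ 1 := by nlinarith
  -- With `m` the mixture, `log (x / m) ≤ x / m - 1 = (1 - α) (x - 1) / m`, where `1 - α ≥ 1/2` and
  -- `m ≤ 1`.
  have h1 : Real.log x - Real.log (α * x + 1 - α) ≤ (x - 1) / 2 := by
    rw [← Real.log_div hx0.ne' hm.ne']
    refine (Real.log_le_sub_one_of_pos (by positivity)).trans ?_
    rw [sub_le_iff_le_add, div_le_iff₀ hm]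
    nlinarith [mul_nonneg (sub_nonneg.2 hx1.le) (sub_nonneg.2 hm1),
      mul_nonneg (sub_nonneg.2 hα1) (sub_nonneg.2 hx1.le)]
  nlinarith [mul_le_mul_of_nonneg_left h1 hα0.le]

lemma one_add_le_rpow_neg (hl : 0 ≤ l) (ht : 0 < t) : 1 + l * (1 - t) ≤ t ^ (-l) := by
  rw [Real.rpow_def_of_pos ht]
  have h1 := Real.add_one_le_exp (Real.log t * -l)
  have h2 := mul_le_mul_of_nonneg_left (Real.log_le_sub_one_of_pos ht) hl
  linarith

lemma hellingerGen_le_sq (hl0 : 0 ≤ l) (hl1 : l ≤ 1 / 2) (ht0 : 0 ≤ t) :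
    hellingerGen l t ≤ l * (1 - t) ^ 2 := by
  rcases ht0.eq_or_lt with rfl | h
  · rw [hellingerGen, Real.zero_rpow (by linarith)]
    simp
  · have h1 := mul_le_mul_of_nonneg_left (one_add_le_rpow_neg hl0 h) ht0
    rw [hellingerGen, show (1 - l : ℝ) = 1 + -l by ring, Real.rpow_add h, Real.rpow_one]
    linarith

lemma sq_le_hellingerGen (hl0 : 0 ≤ l) (hl1 : l ≤ 1 / 2) (ht0 : 0 ≤ t) (ht1 : t ≤ 1) :
    l / 4 * (1 - t) ^ 2 ≤ hellingerGen l t := by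
  refine sub_nonneg.1 (nonneg_of_deriv_nonpos_of_one
    (f := fun t => hellingerGen l t - l / 4 * (1 - t) ^ 2)
    ((continuous_hellingerGen (by linarith)).sub (by fun_prop))
    (fun x hx => (hasDerivAt_hellingerGen hx).sub (hasDerivAt_mul_one_sub_sq _ x))
    (fun x hx0 hx1 => ?_) (by simp [hellingerGen_one]) ht0 ht1)
  have h1 := one_add_le_rpow_neg hl0 hx0
  nlinarith [mul_le_mul_of_nonneg_left h1 (show 0 ≤ 1 - l by linarith),
    mul_nonneg (mul_nonneg hl0 (sub_nonneg.2 hx1.le)) (sub_nonneg.2 hl1)]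

lemma log_half_bounds : 1 / 3 ≤ Real.log 2 / 2 ∧ Real.log 2 / 2 ≤ 1 / 2 := by
  constructor <;> linarith [Real.log_two_gt_d9, Real.log_two_lt_d9]

lemma log_two_le_log_inv (hα0 : 0 < α) (hα1 : α ≤ 1 / 2) : Real.log 2 ≤ Real.log (1 / α) :=
  Real.log_le_log two_pos (by rw [le_div_iff₀ hα0]; linarith)

lemma tilt_bounds (hα0 : 0 < α) (hα1 : α ≤ 1 / 2) (hl : l * Real.log (1 / α) = Real.log 2 / 2) :
    0 < l ∧ l ≤ 1 / 2 := by
  have hL := log_two_le_log_inv hα0 hα1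
  have h2 := Real.log_pos one_lt_two
  constructor
  · by_contra! h
    nlinarith
  · by_contra! h
    nlinarith

lemma log_sub_log_mix_le (hα0 : 0 < α) (hα1 : α ≤ 1 / 2) (ht : 1 ≤ t) :
    Real.log t - Real.log (α * t + 1 - α) ≤ min (Real.log t) (Real.log (1 / α)) := by
  have ht0 : 0 < t := by linarith
  have hm := mix_pos hα0 (by linarith) ht0.le
  refine le_min ?_ ?_
  · have := Real.log_nonneg (show 1 ≤ α * t + 1 - α by nlinarith)
    linarith
  · rw [← Real.log_div ht0.ne' hm.ne']
    refine Real.log_le_log (by positivity) ?_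
    rw [div_le_div_iff₀ hm hα0]
    linarith

/-- Up to `t = 1 / α` the mixture is at most `t ^ (2/3)`, so a third of `log t` survives. Beyond `1
/ α` the difference of logarithms still increases, so its value at `1 / α` suffices. -/
lemma le_log_sub_log_mix (hα0 : 0 < α) (hα1 : α ≤ 1 / 2) (ht : 1 ≤ t) :
    min (Real.log t) (Real.log (1 / α)) ≤ 3 * (Real.log t - Real.log (α * t + 1 - α)) := by
  have ht0 : 0 < t := by linarith
  have hm := mix_pos hα0 (by linarith) ht0.le
  have cube : ∀ s, 1 ≤ s → α * s ≤ 1 → (α * s + 1 - α) ^ 3 ≤ s ^ 2 := by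
    intro s hs h
    have hm0 := mix_pos hα0 (by linarith) (show 0 ≤ s by linarith)
    -- Below `3` the mixture is at most `(s + 1) / 2`, as `α ≤ 1/2`; above `3` the bound `2` is
    -- enough, since `2 ^ 3 ≤ 3 ^ 2`.
    rcases le_total s 3 with h3 | h3
    · calc (α * s + 1 - α) ^ 3 ≤ ((s + 1) / 2) ^ 3 := by
            gcongr
            nlinarith
        _ ≤ s ^ 2 := by
          nlinarith [mul_nonneg (sub_nonneg.2 hs) (sub_nonneg.2 h3),
            mul_nonneg (mul_nonneg (sub_nonneg.2 hs) (sub_nonneg.2 h3)) (sub_nonneg.2 hs)]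
    · calc (α * s + 1 - α) ^ 3 ≤ 2 ^ 3 := by
            gcongr
            linarith
        _ ≤ s ^ 2 := by nlinarith
  have key : ∀ s, 1 ≤ s → α * s ≤ 1 →
      Real.log s ≤ 3 * (Real.log s - Real.log (α * s + 1 - α)) := by
    intro s hs h
    have hm0 := mix_pos hα0 (by linarith) (show 0 ≤ s by linarith)
    have := Real.log_le_log (by positivity) (cube s hs h)
    rw [Real.log_pow, Real.log_pow] at this
    push_cast at this
    linarith
  rcases le_total (α * t) 1 with h | h
  · exact (min_le_left _ _).trans (key t ht h)
  · refine (min_le_right _ _).trans ((key (1 / α) ?_ ?_).trans ?_)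
    · rw [le_div_iff₀ hα0]
      linarith
    · rw [mul_one_div_cancel hα0.ne']
    · have hm1 : α * (1 / α) + 1 - α = 2 - α := by field_simp; ring
      have h2 : 0 < 2 - α := by linarith
      rw [hm1, ← Real.log_div ht0.ne' hm.ne', ← Real.log_div (by positivity) h2.ne']
      refine mul_le_mul_of_nonneg_left (Real.log_le_log (by positivity) ?_) (by norm_num)
      rw [div_div, div_le_div_iff₀ (by positivity) hm]
      nlinarith [mul_nonneg (sub_nonneg.2 h) (show 0 ≤ 1 - α by linarith)]

lemma log_mul_one_sub_rpow_le (hα0 : 0 < α) (hα1 : α ≤ 1 / 2)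
    (hl : l * Real.log (1 / α) = Real.log 2 / 2) (ht : 1 ≤ t) :
    Real.log (1 / α) * (1 - t ^ (-l)) ≤ min (Real.log t) (Real.log (1 / α)) := by
  have ht0 : 0 < t := by linarith
  have hL : 0 < Real.log (1 / α) :=
    (Real.log_pos one_lt_two).trans_le (log_two_le_log_inv hα0 hα1)
  have h1 := Real.log_nonneg ht
  obtain ⟨h2, h3⟩ := log_half_bounds
  refine le_min ?_ ?_
  · have h4 : 1 - t ^ (-l) ≤ l * Real.log t := by
      rw [Real.rpow_def_of_pos ht0]
      linarith [Real.add_one_le_exp (Real.log t * -l)]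
    nlinarith [mul_le_mul_of_nonneg_left h4 hL.le]
  · have := Real.rpow_pos_of_pos ht0 (-l)
    nlinarith

/-- With `v` the minimum, `t ^ (-l) ≤ exp (-l v) ≤ 1 / (1 + l v)`. As `l v ≤ 1/2`, the deficit from
`1` is linear in `l v`, and `L * l` is the constant `log 2 / 2`. -/
lemma le_log_mul_one_sub_rpow (hα0 : 0 < α) (hα1 : α ≤ 1 / 2)
    (hl : l * Real.log (1 / α) = Real.log 2 / 2) (ht : 1 ≤ t) :
    min (Real.log t) (Real.log (1 / α)) ≤ 5 * (Real.log (1 / α) * (1 - t ^ (-l))) := by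
  have ht0 : 0 < t := by linarith
  have hL : 0 < Real.log (1 / α) :=
    (Real.log_pos one_lt_two).trans_le (log_two_le_log_inv hα0 hα1)
  obtain ⟨hl0, hl1⟩ := tilt_bounds hα0 hα1 hl
  obtain ⟨h2, h3⟩ := log_half_bounds
  set L := Real.log (1 / α)
  set v := min (Real.log t) L with hv
  have hv0 : 0 ≤ v := le_min (Real.log_nonneg ht) hL.le
  have hvL : v ≤ L := min_le_right _ _
  have hlv : l * v ≤ 1 / 2 := (mul_le_mul_of_nonneg_left hvL hl0.le).trans (hl.trans_le h3)
  have hlv0 : 0 ≤ l * v := by positivity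
  have h4 : t ^ (-l) ≤ (1 + l * v)⁻¹ := by
    rw [Real.rpow_def_of_pos ht0, mul_neg, Real.exp_neg]
    refine inv_anti₀ (by positivity) ?_
    have h5 := Real.add_one_le_exp (Real.log t * l)
    have h6 := mul_le_mul_of_nonneg_left (min_le_left (Real.log t) L) hl0.le
    linarith
  have h7 : 2 / 3 * (l * v) ≤ 1 - (1 + l * v)⁻¹ := by
    rw [le_sub_comm, inv_le_iff_one_le_mul₀ (by positivity)]
    nlinarith
  have h8 : 2 / 3 * (l * v) ≤ 1 - t ^ (-l) := by linarith
  have h9 : L * (l * v) = (Real.log 2 / 2) * v := by rw [← hl]; ring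
  nlinarith [mul_le_mul_of_nonneg_left h8 hL.le, mul_nonneg (sub_nonneg.2 h2) hv0]

/-- Up to a factor `12` the mutual information generator is at most that of `H_{1-l}`. -/
lemma infoGen_le (hα0 : 0 < α) (hα1 : α ≤ 1 / 2)
    (hl : l * Real.log (1 / α) = Real.log 2 / 2) (ht : 0 ≤ t) :
    infoGen α t ≤ 12 * (α * Real.log (1 / α)) * hellingerGen l t := by
  have hα2 : α < 1 := by linarith
  obtain ⟨hl0, hl1⟩ := tilt_bounds hα0 hα1 hl
  obtain ⟨h2, h3⟩ := log_half_bounds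
  have hL : 0 < Real.log (1 / α) :=
    (Real.log_pos one_lt_two).trans_le (log_two_le_log_inv hα0 hα1)
  rcases le_total t 1 with ht1 | ht1
  -- On `[0, 1]` both sides are multiples of `α (1 - t) ^ 2`, because `l * log (1 / α)` is constant.
  · have h4 := infoGen_le_sq hα0 hα2 ht ht1
    have h5 := mul_le_mul_of_nonneg_left (sq_le_hellingerGen hl0.le hl1 ht ht1)
      (show 0 ≤ 12 * (α * Real.log (1 / α)) by positivity)
    have h6 : 12 * (α * Real.log (1 / α)) * (l / 4 * (1 - t) ^ 2) =
      3 * (Real.log 2 / 2) * (α * (1 - t) ^ 2) := by rw [← hl]; ring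
    have h7 : 0 ≤ α * (1 - t) ^ 2 := by positivity
    nlinarith
  · refine sub_nonneg.1 (nonneg_of_deriv_nonneg_of_one
      (f := fun t => 12 * (α * Real.log (1 / α)) * hellingerGen l t - infoGen α t)
      (((continuous_hellingerGen (by linarith)).const_smul (12 * (α * Real.log (1 / α)))).sub
        continuous_infoGen)
      (fun x hx => ((hasDerivAt_hellingerGen hx).const_mul _).sub (hasDerivAt_infoGen hα0 hα2 hx))
      (fun x hx => ?_) (by simp [hellingerGen_one, infoGen_one]) ht1)
    have h4 := (log_sub_log_mix_le hα0 hα1 hx.le).trans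
      (le_log_mul_one_sub_rpow hα0 hα1 hl hx.le)
    have h5 : 0 ≤ Real.log (1 / α) * (1 - x ^ (-l)) :=
      mul_nonneg hL.le (sub_nonneg.2 (Real.rpow_le_one_of_one_le_of_nonpos hx.le (by linarith)))
    -- The factor `5` fits under `12 * (1 - l)`, which is at least `6`.
    have h6 : Real.log x - Real.log (α * x + 1 - α) ≤
      12 * (1 - l) * (Real.log (1 / α) * (1 - x ^ (-l))) := by nlinarith
    nlinarith [mul_le_mul_of_nonneg_left h6 hα0.le]

/-- Up to a factor `3` the generator of `H_{1-l}` is at most that of the mutual information. -/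
lemma le_infoGen (hα0 : 0 < α) (hα1 : α ≤ 1 / 2)
    (hl : l * Real.log (1 / α) = Real.log 2 / 2) (ht : 0 ≤ t) :
    α * Real.log (1 / α) * hellingerGen l t ≤ 3 * infoGen α t := by
  have hα2 : α < 1 := by linarith
  obtain ⟨hl0, hl1⟩ := tilt_bounds hα0 hα1 hl
  obtain ⟨h2, h3⟩ := log_half_bounds
  have hL : 0 < Real.log (1 / α) :=
    (Real.log_pos one_lt_two).trans_le (log_two_le_log_inv hα0 hα1)
  rcases le_total t 1 with ht1 | ht1
  · have h4 := sq_le_infoGen hα0 hα1 ht ht1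
    have h5 := mul_le_mul_of_nonneg_left (hellingerGen_le_sq hl0.le hl1 ht)
      (show 0 ≤ α * Real.log (1 / α) by positivity)
    have h6 : α * Real.log (1 / α) * (l * (1 - t) ^ 2) =
      (Real.log 2 / 2) * (α * (1 - t) ^ 2) := by rw [← hl]; ring
    have h7 : 0 ≤ α * (1 - t) ^ 2 := by positivity
    nlinarith
  · refine sub_nonneg.1 (nonneg_of_deriv_nonneg_of_one
      (f := fun t => 3 * infoGen α t - α * Real.log (1 / α) * hellingerGen l t)
      ((continuous_infoGen.const_smul (3 : ℝ)).sub
        ((continuous_hellingerGen (by linarith)).const_smul (α * Real.log (1 / α))))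
      (fun x hx => ((hasDerivAt_infoGen hα0 hα2 hx).const_mul 3).sub
        ((hasDerivAt_hellingerGen hx).const_mul _))
      (fun x hx => ?_) (by simp [hellingerGen_one, infoGen_one]) ht1)
    have h4 := (log_mul_one_sub_rpow_le hα0 hα1 hl hx.le).trans
      (le_log_sub_log_mix hα0 hα1 hx.le)
    have h5 : 0 ≤ Real.log (1 / α) * (1 - x ^ (-l)) :=
      mul_nonneg hL.le (sub_nonneg.2 (Real.rpow_le_one_of_one_le_of_nonpos hx.le (by linarith)))
    have h6 : (1 - l) * (Real.log (1 / α) * (1 - x ^ (-l))) ≤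
      3 * (Real.log x - Real.log (α * x + 1 - α)) := by nlinarith
    nlinarith [mul_le_mul_of_nonneg_left h6 hα0.le]

end Generators

/-! ### Pointwise contributions, including points where `q` vanishes. -/

section Terms

/-- The contribution to `I(Θ; X₁)` of a point with masses `a` and `b`. -/
noncomputable def infoTerm (α a b : ℝ) : ℝ :=
  α * (a * Real.log (a / (α * a + (1 - α) * b))) +
    (1 - α) * (b * Real.log (b / (α * a + (1 - α) * b)))

/-- The contribution to `H_s` of a point with masses `a` and `b`. -/
noncomputable def hellingerTerm (s a b : ℝ) : ℝ := s * a + (1 - s) * b - a ^ s * b ^ (1 - s)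

variable {α l s a b : ℝ}

lemma hellingerTerm_nonneg (hs0 : 0 ≤ s) (hs1 : s ≤ 1) (ha : 0 ≤ a) (hb : 0 ≤ b) :
    0 ≤ hellingerTerm s a b :=
  sub_nonneg.2 (Real.geom_mean_le_arith_mean2_weighted hs0 (sub_nonneg.2 hs1) ha hb (by ring))

lemma infoTerm_eq_mul_infoGen (hα0 : 0 < α) (hα1 : α < 1) (ha : 0 ≤ a) (hb : 0 < b) :
    infoTerm α a b = b * infoGen α (a / b) := by
  have hm := mix_pos hα0 hα1 (div_nonneg ha hb.le)
  have h1 : α * a + (1 - α) * b = b * (α * (a / b) + 1 - α) := by field_simp; ring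
  rw [infoTerm, infoGen, h1, ← div_div, div_mul_cancel_left₀ hb.ne', Real.log_inv]
  set m := α * (a / b) + 1 - α with hmdef
  have hma : b * m = α * a + (1 - α) * b := h1.symm
  rcases ha.eq_or_lt with rfl | ha
  · simp [hmdef]
    ring
  · rw [Real.log_div (by positivity) hm.ne']
    have h2 : b * (α * (a / b * Real.log (a / b)) - m * Real.log m) =
      α * a * Real.log (a / b) - (b * m) * Real.log m := by field_simp
    rw [h2, hma]
    ring

lemma hellingerTerm_eq_mul_hellingerGen (ha : 0 ≤ a) (hb : 0 < b) :
    hellingerTerm (1 - l) a b = b * hellingerGen l (a / b) := by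
  have h : a ^ (1 - l) * b ^ l = b * (a / b) ^ (1 - l) := by
    rw [Real.div_rpow ha hb.le, Real.rpow_sub hb, Real.rpow_one]
    field_simp
  rw [hellingerTerm, hellingerGen, sub_sub_cancel, h]
  field_simp

/-- Where `q` has no mass the ratio `a / b` is unavailable; here both contributions are linear in
`a` and are compared directly. -/
lemma infoTerm_zero_right (ha : 0 < a) :
    infoTerm α a 0 = α * Real.log (1 / α) * a := by
  rw [infoTerm, mul_zero, add_zero, div_mul_cancel_right₀ ha.ne', one_div]
  ring

lemma hellingerTerm_zero_right (hl : 0 < l) : hellingerTerm (1 - l) a 0 = (1 - l) * a := by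
  rw [hellingerTerm, sub_sub_cancel, Real.zero_rpow hl.ne']
  ring

lemma infoTerm_zero_left_zero : infoTerm α 0 0 = 0 := by simp [infoTerm]

lemma infoTerm_le (hα0 : 0 < α) (hα1 : α ≤ 1 / 2)
    (hl : l * Real.log (1 / α) = Real.log 2 / 2) (ha : 0 ≤ a) (hb : 0 ≤ b) :
    infoTerm α a b ≤ 12 * (α * Real.log (1 / α)) * hellingerTerm (1 - l) a b := by
  have hα2 : α < 1 := by linarith
  obtain ⟨hl0, hl1⟩ := tilt_bounds hα0 hα1 hl
  have hL : 0 < Real.log (1 / α) :=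
    (Real.log_pos one_lt_two).trans_le (log_two_le_log_inv hα0 hα1)
  rcases hb.eq_or_lt with rfl | hb
  · rcases ha.eq_or_lt with rfl | ha
    · simp [infoTerm_zero_left_zero, hellingerTerm_zero_right hl0]
    · rw [infoTerm_zero_right ha, hellingerTerm_zero_right hl0]
      have : 0 ≤ α * Real.log (1 / α) * a := by positivity
      nlinarith
  · rw [infoTerm_eq_mul_infoGen hα0 hα2 ha hb, hellingerTerm_eq_mul_hellingerGen ha hb,
      mul_left_comm]
    exact mul_le_mul_of_nonneg_left (infoGen_le hα0 hα1 hl (by positivity)) hb.le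

lemma le_infoTerm (hα0 : 0 < α) (hα1 : α ≤ 1 / 2)
    (hl : l * Real.log (1 / α) = Real.log 2 / 2) (ha : 0 ≤ a) (hb : 0 ≤ b) :
    α * Real.log (1 / α) * hellingerTerm (1 - l) a b ≤ 3 * infoTerm α a b := by
  have hα2 : α < 1 := by linarith
  obtain ⟨hl0, hl1⟩ := tilt_bounds hα0 hα1 hl
  have hL : 0 < Real.log (1 / α) :=
    (Real.log_pos one_lt_two).trans_le (log_two_le_log_inv hα0 hα1)
  rcases hb.eq_or_lt with rfl | hb
  · rcases ha.eq_or_lt with rfl | ha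
    · simp [infoTerm_zero_left_zero, hellingerTerm_zero_right hl0]
    · rw [infoTerm_zero_right ha, hellingerTerm_zero_right hl0]
      have : 0 ≤ α * Real.log (1 / α) * a := by positivity
      nlinarith
  · rw [infoTerm_eq_mul_infoGen hα0 hα2 ha hb, hellingerTerm_eq_mul_hellingerGen ha hb,
      mul_left_comm, mul_left_comm 3]
    exact mul_le_mul_of_nonneg_left (le_infoGen hα0 hα1 hl (by positivity)) hb.le

/-- Weighted AM-GM applied to `a ^ (1 - l) * b ^ l = (√a * √b) ^ (2 l) * a ^ (1 - 2 l)`. -/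
lemma two_mul_hellingerTerm_half_le (hl0 : 0 < l) (hl1 : l ≤ 1 / 2) (ha : 0 ≤ a) (hb : 0 ≤ b) :
    2 * l * hellingerTerm (1 / 2) a b ≤ hellingerTerm (1 - l) a b := by
  have h1 := Real.geom_mean_le_arith_mean2_weighted (w₁ := 2 * l) (w₂ := 1 - 2 * l)
    (p₁ := a ^ (1 / 2 : ℝ) * b ^ (1 / 2 : ℝ)) (p₂ := a)
    (by positivity) (by linarith) (by positivity) ha (by ring)
  have h2 : (a ^ (1 / 2 : ℝ) * b ^ (1 / 2 : ℝ)) ^ (2 * l) * a ^ (1 - 2 * l) =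
      a ^ (1 - l) * b ^ l := by
    rw [Real.mul_rpow (by positivity) (by positivity), ← Real.rpow_mul ha, ← Real.rpow_mul hb,
      show (1 / 2 : ℝ) * (2 * l) = l by ring, mul_right_comm, ← Real.rpow_add_of_nonneg ha hl0.le
      (by linarith), show l + (1 - 2 * l) = 1 - l by ring]
  rw [h2] at h1
  rw [hellingerTerm, hellingerTerm, sub_sub_cancel, show (1 - 1 / 2 : ℝ) = 1 / 2 by norm_num]
  linarith

end Terms

/-! ### The divergences as sums over points. -/

section Divergences

lemma hellingerDiv_le_one {𝒳 : Type*} [MeasurableSpace 𝒳] {p q : Measure 𝒳} {s : ℝ} :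
    hellingerDiv s p q ≤ 1 :=
  sub_le_self _ (tsum_nonneg fun i => by positivity)

variable {𝒳 : Type*} [Countable 𝒳] [MeasurableSpace 𝒳] [MeasurableSingletonClass 𝒳]

lemma klDiv_eq_tsum {μ ν : Measure 𝒳} [IsFiniteMeasure μ] [IsFiniteMeasure ν] (h : μ ≪ ν) :
    InformationTheory.klDiv μ ν =
      ∑' i, ENNReal.ofReal (ν.real {i} * InformationTheory.klFun (μ.real {i} / ν.real {i})) := by
  rw [InformationTheory.klDiv_eq_lintegral_klFun_of_ac h, lintegral_countable']
  refine tsum_congr fun i => ?_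
  by_cases hi : ν {i} = 0
  · simp [hi, measureReal_def]
  · have h1 : μ.rnDeriv ν i = μ {i} / ν {i} := by
      have := Measure.setLIntegral_rnDeriv h {i}
      rw [lintegral_singleton] at this
      rw [← this, ENNReal.mul_div_cancel_right hi (measure_ne_top _ _)]
    rw [h1, ENNReal.toReal_div, mul_comm, ENNReal.ofReal_mul measureReal_nonneg,
      ofReal_measureReal]
    rfl

variable {p q : Measure 𝒳} [IsProbabilityMeasure p] [IsProbabilityMeasure q]

lemma infoPerSample_eq_tsum {α : ℝ} (hα0 : 0 < α) (hα1 : α < 1) :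
    infoPerSample α p q = ∑' i, ENNReal.ofReal (infoTerm α (p.real {i}) (q.real {i})) := by
  have hα2 : 0 < 1 - α := sub_pos.2 hα1
  have hfst : (jointLaw α p q).map Prod.fst =
      ENNReal.ofReal α • Measure.dirac true + ENNReal.ofReal (1 - α) • Measure.dirac false := by
    rw [jointLaw, Measure.map_add _ _ measurable_fst, Measure.map_smul, Measure.map_smul,
      Measure.map_fst_prod, Measure.map_fst_prod]
    simp
  have hsnd : (jointLaw α p q).map Prod.snd =
      ENNReal.ofReal α • p + ENNReal.ofReal (1 - α) • q := by
    rw [jointLaw, Measure.map_add _ _ measurable_snd, Measure.map_smul, Measure.map_smul,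
      Measure.map_snd_prod, Measure.map_snd_prod]
    simp
  have hJ : IsFiniteMeasure (jointLaw α p q) := by
    refine ⟨?_⟩
    simp [jointLaw]
  have hF : IsFiniteMeasure ((jointLaw α p q).map Prod.fst) := inferInstance
  have hS : IsFiniteMeasure ((jointLaw α p q).map Prod.snd) := inferInstance
  have hJt : ∀ i, (jointLaw α p q).real {(true, i)} = α * p.real {i} := fun i => by
    simp [measureReal_def, jointLaw, ← Set.singleton_prod_singleton, hα0.le]
  have hJf : ∀ i, (jointLaw α p q).real {(false, i)} = (1 - α) * q.real {i} := fun i => by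
    simp [measureReal_def, jointLaw, ← Set.singleton_prod_singleton, hα1.le]
  have hm : ∀ i, ((jointLaw α p q).map Prod.snd).real {i} =
      α * p.real {i} + (1 - α) * q.real {i} := fun i => by
    simp [measureReal_def, hsnd, ENNReal.toReal_add, ENNReal.mul_ne_top, hα0.le, hα1.le]
  have hPt : ∀ i, (((jointLaw α p q).map Prod.fst).prod ((jointLaw α p q).map Prod.snd)).real
      {(true, i)} = α * (α * p.real {i} + (1 - α) * q.real {i}) := fun i => by
    rw [← Set.singleton_prod_singleton, measureReal_prod_prod, hm, hfst]
    simp [measureReal_def, hα0.le]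
  have hPf : ∀ i, (((jointLaw α p q).map Prod.fst).prod ((jointLaw α p q).map Prod.snd)).real
      {(false, i)} = (1 - α) * (α * p.real {i} + (1 - α) * q.real {i}) := fun i => by
    rw [← Set.singleton_prod_singleton, measureReal_prod_prod, hm, hfst]
    simp [measureReal_def, hα1.le]
  -- It suffices to look at atoms: the marginal mass of a point vanishes only if both weighted
  -- masses do.
  have hac : jointLaw α p q ≪
      ((jointLaw α p q).map Prod.fst).prod ((jointLaw α p q).map Prod.snd) := by
    refine Measure.AbsolutelyContinuous.mk fun s _ hs => ?_
    rw [← Set.biUnion_of_singleton s, measure_biUnion_null_iff (Set.to_countable s)] at hs ⊢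
    intro x hx
    have h0 := hs x hx
    obtain ⟨c, i⟩ := x
    rw [← measureReal_eq_zero_iff] at h0 ⊢
    have h1 : 0 ≤ p.real {i} := measureReal_nonneg
    have h2 : 0 ≤ q.real {i} := measureReal_nonneg
    cases c
    · rw [hPf, mul_eq_zero, or_iff_right hα2.ne', add_eq_zero_iff_of_nonneg (by positivity)
        (by positivity)] at h0
      rw [hJf, h0.2]
    · rw [hPt, mul_eq_zero, or_iff_right hα0.ne', add_eq_zero_iff_of_nonneg (by positivity)
        (by positivity)] at h0
      rw [hJt, h0.1]
  have hid : (jointLaw α p q).map (fun ω : Bool × 𝒳 => (ω.1, ω.2)) = jointLaw α p q :=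
    Measure.map_id
  rw [infoPerSample, mutualInfo, hid, klDiv_eq_tsum hac,
    ENNReal.tsum_prod (f := fun c i => ENNReal.ofReal
      ((((jointLaw α p q).map Prod.fst).prod ((jointLaw α p q).map Prod.snd)).real {(c, i)} *
        InformationTheory.klFun ((jointLaw α p q).real {(c, i)} /
          (((jointLaw α p q).map Prod.fst).prod ((jointLaw α p q).map Prod.snd)).real {(c, i)}))),
    tsum_bool, ← ENNReal.tsum_add]
  refine tsum_congr fun i => ?_
  rw [hJf, hJt, hPf, hPt]
  have ha : 0 ≤ p.real {i} := measureReal_nonneg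
  have hb : 0 ≤ q.real {i} := measureReal_nonneg
  generalize p.real {i} = a at ha
  generalize q.real {i} = b at hb
  have hm0 : 0 ≤ α * a + (1 - α) * b := by positivity
  rw [mul_div_mul_left _ _ hα0.ne', mul_div_mul_left _ _ hα2.ne', ← ENNReal.ofReal_add
    (mul_nonneg (by positivity) (InformationTheory.klFun_nonneg (by positivity)))
    (mul_nonneg (by positivity) (InformationTheory.klFun_nonneg (by positivity)))]
  congr 1
  -- The affine parts of `klFun` cancel between the two labels, since the mixture is the weighted
  -- mean of `a` and `b`.
  rw [infoTerm, InformationTheory.klFun_apply, InformationTheory.klFun_apply]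
  rcases hm0.eq_or_lt with h0 | h0
  · have h1 := (add_eq_zero_iff_of_nonneg (by positivity) (by positivity)).1 h0.symm
    have h2 : a = 0 := by simpa [hα0.ne'] using h1.1
    have h3 : b = 0 := by simpa [hα2.ne'] using h1.2
    simp [h2, h3]
  · generalize Real.log (a / (α * a + (1 - α) * b)) = x
    generalize Real.log (b / (α * a + (1 - α) * b)) = y
    field_simp
    ring

lemma hasSum_real_singleton (p : Measure 𝒳) [IsProbabilityMeasure p] :
    HasSum (fun i => p.real {i}) 1 := by
  have h := tsum_singleton_eq_one p
  have h2 : HasSum (fun i => (p {i}).toReal) (∑' i, (p {i}).toReal) :=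
    (ENNReal.summable_toReal (by rw [h]; exact ENNReal.one_ne_top)).hasSum
  rwa [← ENNReal.tsum_toReal_eq (fun i => measure_ne_top _ _), h, ENNReal.toReal_one] at h2

lemma summable_rpow_mul_rpow {s : ℝ} (hs0 : 0 ≤ s) (hs1 : s ≤ 1) :
    Summable fun i => p.real {i} ^ s * q.real {i} ^ (1 - s) := by
  refine Summable.of_nonneg_of_le (fun i => by positivity) (fun i => ?_)
    (((hasSum_real_singleton p).mul_left s).add
      ((hasSum_real_singleton q).mul_left (1 - s))).summable
  exact sub_nonneg.1 (hellingerTerm_nonneg hs0 hs1 measureReal_nonneg measureReal_nonneg)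

lemma hasSum_hellingerTerm {s : ℝ} (hs0 : 0 ≤ s) (hs1 : s ≤ 1) :
    HasSum (fun i => hellingerTerm s (p.real {i}) (q.real {i})) (hellingerDiv s p q) := by
  have := (((hasSum_real_singleton p).mul_left s).add
    ((hasSum_real_singleton q).mul_left (1 - s))).sub
      (summable_rpow_mul_rpow (p := p) (q := q) hs0 hs1).hasSum
  rwa [mul_one, mul_one, add_sub_cancel] at this

lemma ofReal_hellingerDiv_eq_tsum {s : ℝ} (hs0 : 0 ≤ s) (hs1 : s ≤ 1) :
    ENNReal.ofReal (hellingerDiv s p q) =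
      ∑' i, ENNReal.ofReal (hellingerTerm s (p.real {i}) (q.real {i})) := by
  rw [← (hasSum_hellingerTerm hs0 hs1).tsum_eq]
  exact ENNReal.ofReal_tsum_of_nonneg
    (fun i => hellingerTerm_nonneg hs0 hs1 measureReal_nonneg measureReal_nonneg)
    (hasSum_hellingerTerm hs0 hs1).summable

lemma hellingerDiv_nonneg {s : ℝ} (hs0 : 0 ≤ s) (hs1 : s ≤ 1) : 0 ≤ hellingerDiv s p q :=
  (hasSum_hellingerTerm hs0 hs1).nonneg
    fun _ => hellingerTerm_nonneg hs0 hs1 measureReal_nonneg measureReal_nonneg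

lemma hellingerSq_eq : hellingerSq p q = hellingerDiv (1 / 2) p q := by
  have h := (hasSum_hellingerTerm (p := p) (q := q) (s := 1 / 2) (by norm_num)
    (by norm_num)).tsum_eq
  rw [← h, hellingerSq, ← tsum_mul_left]
  refine tsum_congr fun i => ?_
  rw [hellingerTerm, show (1 - 1 / 2 : ℝ) = 1 / 2 by norm_num, ← Real.sqrt_eq_rpow,
    ← Real.sqrt_eq_rpow]
  have h1 := Real.sq_sqrt (measureReal_nonneg (μ := p) (s := {i}))
  have h2 := Real.sq_sqrt (measureReal_nonneg (μ := q) (s := {i}))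
  linear_combination (1 / 2) * h1 + (1 / 2) * h2

lemma two_mul_hellingerSq_le {l : ℝ} (hl0 : 0 < l) (hl1 : l ≤ 1 / 2) :
    2 * l * hellingerSq p q ≤ hellingerDiv (1 - l) p q := by
  rw [hellingerSq_eq]
  exact hasSum_le (fun i => two_mul_hellingerTerm_half_le hl0 hl1 measureReal_nonneg
    measureReal_nonneg) ((hasSum_hellingerTerm (by norm_num) (by norm_num)).mul_left _)
    (hasSum_hellingerTerm (by linarith) (by linarith))

lemma affinity_eq_ofReal {s : ℝ} (hs0 : 0 ≤ s) (hs1 : s ≤ 1) :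
    affinity s (fun i => p {i}) (fun i => q {i}) = ENNReal.ofReal (1 - hellingerDiv s p q) := by
  rw [hellingerDiv, sub_sub_cancel, ENNReal.ofReal_tsum_of_nonneg (fun i => by positivity)
    (summable_rpow_mul_rpow hs0 hs1), affinity]
  refine tsum_congr fun i => ?_
  rw [ENNReal.ofReal_mul (by positivity), ← ENNReal.ofReal_rpow_of_nonneg measureReal_nonneg hs0,
    ← ENNReal.ofReal_rpow_of_nonneg measureReal_nonneg (sub_nonneg.2 hs1), ofReal_measureReal,
    ofReal_measureReal]

lemma toReal_affinity {s : ℝ} (hs0 : 0 ≤ s) (hs1 : s ≤ 1) :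
    (affinity s (fun i => p {i}) (fun i => q {i})).toReal = 1 - hellingerDiv s p q := by
  rw [affinity_eq_ofReal hs0 hs1, ENNReal.toReal_ofReal (sub_nonneg.2 hellingerDiv_le_one)]

variable {α l : ℝ}

lemma infoPerSample_le (hα0 : 0 < α) (hα1 : α ≤ 1 / 2)
    (hl : l * Real.log (1 / α) = Real.log 2 / 2) :
    infoPerSample α p q ≤
      12 * (ENNReal.ofReal (α * Real.log (1 / α)) * .ofReal (hellingerDiv (1 - l) p q)) := by
  obtain ⟨hl0, hl1⟩ := tilt_bounds hα0 hα1 hl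
  have hL : 0 < Real.log (1 / α) :=
    (Real.log_pos one_lt_two).trans_le (log_two_le_log_inv hα0 hα1)
  rw [infoPerSample_eq_tsum hα0 (by linarith),
    ofReal_hellingerDiv_eq_tsum (by linarith) (by linarith), ← mul_assoc, ← ENNReal.tsum_mul_left]
  refine ENNReal.tsum_le_tsum fun i => ?_
  rw [show (12 : ℝ≥0∞) = ENNReal.ofReal 12 by norm_num, ← ENNReal.ofReal_mul (by norm_num),
    ← ENNReal.ofReal_mul (by positivity)]
  exact ENNReal.ofReal_le_ofReal (infoTerm_le hα0 hα1 hl measureReal_nonneg measureReal_nonneg)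

lemma le_infoPerSample (hα0 : 0 < α) (hα1 : α ≤ 1 / 2)
    (hl : l * Real.log (1 / α) = Real.log 2 / 2) :
    ENNReal.ofReal (α * Real.log (1 / α)) * .ofReal (hellingerDiv (1 - l) p q) ≤
      3 * infoPerSample α p q := by
  obtain ⟨hl0, hl1⟩ := tilt_bounds hα0 hα1 hl
  have hL : 0 < Real.log (1 / α) :=
    (Real.log_pos one_lt_two).trans_le (log_two_le_log_inv hα0 hα1)
  rw [infoPerSample_eq_tsum hα0 (by linarith),
    ofReal_hellingerDiv_eq_tsum (by linarith) (by linarith), ← ENNReal.tsum_mul_left,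
    ← ENNReal.tsum_mul_left]
  refine ENNReal.tsum_le_tsum fun i => ?_
  rw [show (3 : ℝ≥0∞) = ENNReal.ofReal 3 by norm_num, ← ENNReal.ofReal_mul (by positivity),
    ← ENNReal.ofReal_mul (by positivity)]
  exact ENNReal.ofReal_le_ofReal (le_infoTerm hα0 hα1 hl measureReal_nonneg measureReal_nonneg)

end Divergences

/-! ### Upper and lower bounds on the sample size. -/

section Bounds

variable {𝒳 : Type*} [Countable 𝒳] [MeasurableSpace 𝒳] [MeasurableSingletonClass 𝒳]
  {p q : Measure 𝒳} [IsProbabilityMeasure p] [IsProbabilityMeasure q] {α δ l : ℝ}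

lemma solvableWith_of_rpow_mul_exp_le {s : ℝ} (hs0 : 0 ≤ s) (hs1 : s ≤ 1) (hα0 : 0 ≤ α)
    (hα1 : α ≤ 1) {n : ℕ} (h : α ^ s * Real.exp (-(n * hellingerDiv s p q)) ≤ δ) :
    SolvableWith p q α δ n := by
  have hδ : 0 ≤ δ := le_trans (by positivity) h
  have hα2 : 0 ≤ 1 - α := sub_nonneg.2 hα1
  have hs2 : 0 ≤ 1 - s := sub_nonneg.2 hs1
  have hH : 0 ≤ 1 - hellingerDiv s p q := sub_nonneg.2 hellingerDiv_le_one
  rw [solvableWith_iff p q hα0 hα1 hδ]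
  refine (optError_le_affinity_pow hs0 hs1 n _ _).trans ?_
  rw [affinity_eq_ofReal hs0 hs1, ENNReal.ofReal_rpow_of_nonneg hα0 hs0,
    ENNReal.ofReal_rpow_of_nonneg hα2 hs2, ← ENNReal.ofReal_pow hH,
    ← ENNReal.ofReal_mul (by positivity), ← ENNReal.ofReal_mul (by positivity)]
  refine ENNReal.ofReal_le_ofReal (le_trans ?_ h)
  have h1 : (1 - α) ^ (1 - s) ≤ 1 := Real.rpow_le_one hα2 (by linarith) hs2
  have h2 : (1 - hellingerDiv s p q) ^ n ≤ Real.exp (-(n * hellingerDiv s p q)) := by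
    rw [← mul_neg, Real.exp_nat_mul]
    gcongr
    linarith [Real.add_one_le_exp (-hellingerDiv s p q)]
  calc α ^ s * (1 - α) ^ (1 - s) * (1 - hellingerDiv s p q) ^ n
      ≤ α ^ s * 1 * Real.exp (-(n * hellingerDiv s p q)) := by gcongr
    _ = _ := by rw [mul_one]

/-- Rounding `B / H_s` up costs at most one sample, and `1 ≤ 1 / H_s`. -/
lemma sampleComplexity_le_div {s B : ℝ} (hs0 : 0 ≤ s) (hs1 : s ≤ 1) (hα0 : 0 ≤ α)
    (hα1 : α ≤ 1) (hB : 0 ≤ B) (h : α ^ s * Real.exp (-B) ≤ δ) :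
    (sampleComplexity p q α δ : ℝ≥0∞) ≤
      ENNReal.ofReal (B + 1) / ENNReal.ofReal (hellingerDiv s p q) := by
  have hB1 : 0 < B + 1 := by linarith
  rcases (hellingerDiv_nonneg (p := p) (q := q) hs0 hs1).eq_or_lt with h0 | h0
  · rw [← h0, ENNReal.ofReal_zero, ENNReal.div_zero (by simpa using hB1)]
    exact le_top
  · have hH1 : hellingerDiv s p q ≤ 1 := hellingerDiv_le_one
    have hs : SolvableWith p q α δ ⌈B / hellingerDiv s p q⌉₊ := by
      refine solvableWith_of_rpow_mul_exp_le hs0 hs1 hα0 hα1 (le_trans ?_ h)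
      gcongr
      exact (div_le_iff₀ h0).1 (Nat.le_ceil _)
    calc (sampleComplexity p q α δ : ℝ≥0∞) ≤ ((⌈B / hellingerDiv s p q⌉₊ : ℕ∞) : ℝ≥0∞) :=
          ENat.toENNReal_mono (sampleComplexity_le hs)
      _ = ENNReal.ofReal ⌈B / hellingerDiv s p q⌉₊ := by simp
      _ ≤ ENNReal.ofReal ((B + 1) / hellingerDiv s p q) := by
          refine ENNReal.ofReal_le_ofReal ((Nat.ceil_lt_add_one (by positivity)).le.trans ?_)
          rw [add_div]
          gcongr
          rwa [one_le_div h0]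
      _ = _ := ENNReal.ofReal_div_of_pos h0

/-- AM-GM gives `√(a b) ≤ x * min a b + y * max a b`, and `max a b ≤ a + b`. -/
lemma rpow_half_mul_rpow_half_le {x y a b : ℝ} (hx : 0 ≤ x) (hy : 0 ≤ y) (h : 4 * x * y = 1)
    (ha : 0 ≤ a) (hb : 0 ≤ b) :
    a ^ (1 / 2 : ℝ) * b ^ (1 - 1 / 2 : ℝ) ≤ y * a + y * b + x * min a b := by
  have key : ∀ u v : ℝ, u * v ≤ x * u ^ 2 + y * v ^ 2 := by
    intro u v
    have h1 : x * (u - 2 * y * v) ^ 2 = x * u ^ 2 - (4 * x * y) * (u * v) + (4 * x * y) * (y * v ^ 2)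
      := by ring
    rw [h] at h1
    have h2 : 0 ≤ x * (u - 2 * y * v) ^ 2 := by positivity
    linarith
  rw [show (1 - 1 / 2 : ℝ) = 1 / 2 by norm_num, ← Real.sqrt_eq_rpow, ← Real.sqrt_eq_rpow]
  have h1 := key √a √b
  have h2 := key √b √a
  rw [Real.sq_sqrt ha, Real.sq_sqrt hb] at h1 h2
  rcases le_total a b with hab | hab
  · rw [min_eq_left hab]
    nlinarith [mul_nonneg hy ha]
  · rw [min_eq_right hab]
    nlinarith [mul_nonneg hy hb]

lemma SolvableWith.affinity_pow_le (hα0 : 0 < α) (hα1 : α < 1) (hδ : 0 < δ) {n : ℕ}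
    (h : SolvableWith p q α δ n) :
    α * (1 - α) * (1 - hellingerSq p q) ^ (2 * n) ≤ δ := by
  have hα2 : 0 < 1 - α := sub_pos.2 hα1
  have hsδ := Real.sqrt_pos.2 hδ
  have hH : 0 ≤ 1 - hellingerSq p q := by
    rw [hellingerSq_eq]
    exact sub_nonneg.2 hellingerDiv_le_one
  -- These weights balance the two parts: each contributes `√δ / 2`.
  have key := toReal_affinity_pow_mul_le (tsum_singleton_eq_one p) (tsum_singleton_eq_one q)
    (s := 1 / 2) (by norm_num) (by norm_num) (A := √δ / 2) (B := √δ / 2) (K := 1 / (2 * √δ))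
    (by positivity) (by positivity) (by positivity)
    (fun a b ha hb => rpow_half_mul_rpow_half_le (by positivity) (by positivity)
      (by field_simp; norm_num) ha hb)
    hα0.le hα2.le hδ.le ((solvableWith_iff p q hα0.le hα1.le hδ.le n).1 h)
  rw [toReal_affinity (by norm_num) (by norm_num), ← hellingerSq_eq,
    show (1 - 1 / 2 : ℝ) = 1 / 2 by norm_num, ← Real.sqrt_eq_rpow, ← Real.sqrt_eq_rpow] at key
  have h1 : √δ / 2 * α + √δ / 2 * (1 - α) + 1 / (2 * √δ) * δ = √δ := by
    have : 1 / (2 * √δ) * δ = √δ / 2 := by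
      rw [one_div_mul_eq_div, div_eq_iff (by positivity)]
      nlinarith [Real.mul_self_sqrt hδ.le]
    rw [this]
    ring
  rw [h1] at key
  have h2 := pow_le_pow_left₀ (by positivity) key 2
  rw [Real.sq_sqrt hδ.le, mul_pow, mul_pow, Real.sq_sqrt hα0.le, Real.sq_sqrt hα2.le, ← pow_mul,
    mul_comm n] at h2
  linarith

lemma SolvableWith.log_le_mul_hellingerSq (hh : hellingerSq p q ≤ 1 / 8) (hα0 : 0 < α)
    (hα1 : α ≤ 1 / 2) (hδ : 0 < δ) {n : ℕ} (h : SolvableWith p q α δ n) :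
    Real.log (α / (2 * δ)) ≤ 3 * (n * hellingerSq p q) := by
  have h0 : 0 ≤ hellingerSq p q := by
    rw [hellingerSq_eq]
    exact hellingerDiv_nonneg (by norm_num) (by norm_num)
  have h1 := h.affinity_pow_le hα0 (by linarith) hδ
  set x := hellingerSq p q
  have hx : 0 < 1 - x := by linarith
  have h2 : α / (2 * δ) ≤ ((1 - x) ^ (2 * n))⁻¹ := by
    rw [div_le_iff₀ (by positivity), inv_mul_eq_div, le_div_iff₀ (by positivity)]
    have : 0 ≤ α * (1 - x) ^ (2 * n) := by positivity
    nlinarith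
  have h3 := Real.log_le_log (by positivity) h2
  rw [Real.log_inv, Real.log_pow] at h3
  have h4 : -Real.log (1 - x) ≤ 3 / 2 * x := by
    have h5 := Real.one_sub_inv_le_log_of_pos hx
    -- Smallness of `h²` enters here: it keeps `-log (1 - x)` linear in `x`.
    have h6 : (1 - x)⁻¹ ≤ 1 + 3 / 2 * x := by
      rw [inv_le_iff_one_le_mul₀ hx]
      nlinarith
    linarith
  push_cast at h3
  have h7 := mul_le_mul_of_nonneg_left h4 (Nat.cast_nonneg (α := ℝ) n)
  linarith

/-- The exponent `1 - l` costs only the factor `α ^ (-l) = exp m`. -/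
lemma rpow_one_sub_tilt (hα0 : 0 < α) (m : ℝ) (hl : l * Real.log (1 / α) = m) :
    α ^ (1 - l) = α * Real.exp m := by
  rw [sub_eq_add_neg, Real.rpow_add hα0, Real.rpow_one, Real.rpow_def_of_pos hα0, ← hl, one_div,
    Real.log_inv]
  ring_nf

/-- At zero samples the affinity side equals `α R`, while an error of `α / 4` leaves the right side
below it by the factor-`3/4` share of `α (R (1 - l) - 1)`. Bernoulli's inequality turns this gap
into a lower bound for `n * H_{1-l}`. -/
lemma SolvableWith.one_le_mul_hellingerDiv_of_le_eighth (hα0 : 0 < α) (hα1 : α ≤ 1 / 8)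
    (hδ : 0 ≤ δ) (hδα : δ ≤ α / 4) (hl : l * Real.log (1 / α) = Real.log 2 / 2) {n : ℕ}
    (h : SolvableWith p q α δ n) : 1 ≤ 20 * (n * hellingerDiv (1 - l) p q) := by
  obtain ⟨hl0, hl1⟩ := tilt_bounds hα0 (by linarith) hl
  have hα2 : 0 < 1 - α := by linarith
  have hl6 : l ≤ 1 / 6 := by
    have h1 : 3 * Real.log 2 ≤ Real.log (1 / α) := by
      rw [show 3 * Real.log 2 = Real.log 8 by
        rw [show (8 : ℝ) = 2 ^ 3 by norm_num, Real.log_pow]; norm_num]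
      exact Real.log_le_log (by norm_num) (by rw [le_div_iff₀ hα0]; linarith)
    have h2 := Real.log_pos one_lt_two
    nlinarith [mul_le_mul_of_nonneg_left h1 hl0.le]
  -- `r` is the prior ratio, where Young's inequality is to be tight. Up to the factor `(1 - α) ^
  -- l`, `R` is `√2`; with `l ≤ 1/6` this makes `R * (1 - l) > 1`.
  set r := (1 - α) / α with hr
  have hr0 : 0 < r := by positivity
  set R := r ^ l with hR
  have hR0 : 0 < R := by positivity
  have hαR : α ^ (1 - l) * (1 - α) ^ l = α * R := by
    rw [hR, hr, Real.div_rpow hα2.le hα0.le, Real.rpow_sub hα0, Real.rpow_one]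
    field_simp
  have hR2 : 7 / 4 ≤ R ^ 2 := by
    have h1 : (7 / 8 : ℝ) ≤ ((1 - α) ^ l) ^ 2 := by
      rw [← Real.rpow_natCast, ← Real.rpow_mul hα2.le]
      calc (7 / 8 : ℝ) ≤ (1 - α) ^ (1 : ℝ) := by rw [Real.rpow_one]; linarith
        _ ≤ _ := Real.rpow_le_rpow_of_exponent_ge hα2 (by linarith) (by push_cast; linarith)
    have h2 := rpow_one_sub_tilt hα0 _ hl
    have h3 : R = Real.exp (Real.log 2 / 2) * (1 - α) ^ l := by
      rw [h2, mul_assoc] at hαR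
      exact (mul_left_cancel₀ hα0.ne' hαR).symm
    have h4 : Real.exp (Real.log 2 / 2) ^ 2 = 2 := by
      rw [← Real.exp_nat_mul]
      push_cast
      rw [mul_div_cancel₀ _ (two_ne_zero), Real.exp_log two_pos]
    rw [h3, mul_pow, h4]
    linarith
  have hR1 : 13 / 10 ≤ R := by nlinarith
  have hK : 0 ≤ R * (1 - l) - 1 := by nlinarith
  have key := toReal_affinity_pow_mul_le (tsum_singleton_eq_one p) (tsum_singleton_eq_one q)
    (s := 1 - l) (by linarith) (by linarith) (A := 1) (B := R * (l / r)) (K := R * (1 - l) - 1)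
    zero_le_one (by positivity) hK
    -- For `a ≤ b` this is Young's inequality for `a` and `b / r`, and `A + K = R * (1 - l)`. For `b
    -- ≤ a` the term `A * a` alone suffices.
    (fun a b ha hb => by
      rw [sub_sub_cancel]
      rcases le_total a b with hab | hab
      · rw [min_eq_left hab]
        have h1 := mul_le_mul_of_nonneg_left
          (Real.geom_mean_le_arith_mean2_weighted (w₁ := 1 - l) (w₂ := l) (p₁ := a)
            (p₂ := b / r) (by linarith) hl0.le ha (by positivity) (by ring)) hR0.le
        have h2 : R * (a ^ (1 - l) * (b / r) ^ l) = a ^ (1 - l) * b ^ l := by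
          rw [Real.div_rpow hb hr0.le, ← hR]
          field_simp
        rw [h2] at h1
        refine h1.trans_eq ?_
        ring
      · rw [min_eq_right hab]
        have h1 : a ^ (1 - l) * b ^ l ≤ a := by
          calc a ^ (1 - l) * b ^ l ≤ a ^ (1 - l) * a ^ l := by gcongr
            _ = a := by
              rw [← Real.rpow_add_of_nonneg ha (by linarith) hl0.le, sub_add_cancel,
                Real.rpow_one]
        have h2 : 0 ≤ R * (l / r) * b := by positivity
        nlinarith [mul_nonneg hK hb])
    hα0.le hα2.le hδ ((solvableWith_iff p q hα0.le (by linarith) hδ n).1 h)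
  rw [toReal_affinity (by linarith) (by linarith), sub_sub_cancel, hαR,
    show R * (l / r) * (1 - α) = α * (R * l) by rw [hr]; field_simp] at key
  have h1 := key.trans (add_le_add_right (mul_le_mul_of_nonneg_left hδα hK) _)
  have h2 : (1 - hellingerDiv (1 - l) p q) ^ n * R ≤ 1 + R * l + (R * (1 - l) - 1) / 4 := by
    refine le_of_mul_le_mul_left ?_ hα0
    linarith
  have h3 : 1 + n * (-hellingerDiv (1 - l) p q) ≤ (1 + -hellingerDiv (1 - l) p q) ^ n :=
    one_add_mul_le_pow (by linarith [hellingerDiv_le_one (p := p) (q := q) (s := 1 - l)]) n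
  rw [← sub_eq_add_neg] at h3
  nlinarith [mul_le_mul_of_nonneg_right h3 hR0.le]

/-- For `α ≥ 1/8` the tilt is at least `1/6`, so `H_{1-l}` dominates a multiple of `h²` and the
bound through `h²` suffices. -/
lemma SolvableWith.one_le_mul_hellingerDiv (hh : hellingerSq p q ≤ 1 / 8) (hα0 : 0 < α)
    (hα1 : α ≤ 1 / 2) (hδ : 0 < δ) (hδα : δ ≤ α / 4)
    (hl : l * Real.log (1 / α) = Real.log 2 / 2) {n : ℕ}
    (h : SolvableWith p q α δ n) : 1 ≤ 20 * (n * hellingerDiv (1 - l) p q) := by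
  rcases le_total α (1 / 8) with hα | hα
  · exact h.one_le_mul_hellingerDiv_of_le_eighth hα0 hα hδ.le hδα hl
  · obtain ⟨hl0, hl1⟩ := tilt_bounds hα0 hα1 hl
    have hl6 : 1 / 6 ≤ l := by
      have h1 : Real.log (1 / α) ≤ 3 * Real.log 2 := by
        rw [show 3 * Real.log 2 = Real.log 8 by
          rw [show (8 : ℝ) = 2 ^ 3 by norm_num, Real.log_pow]; norm_num]
        exact Real.log_le_log (by positivity) (by rw [div_le_iff₀ hα0]; linarith)
      have h2 := Real.log_pos one_lt_two
      nlinarith [mul_le_mul_of_nonneg_left h1 hl0.le]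
    have h1 := h.log_le_mul_hellingerSq hh hα0 hα1 hδ
    have h2 : Real.log 2 ≤ Real.log (α / (2 * δ)) :=
      Real.log_le_log two_pos (by rw [le_div_iff₀ (by positivity)]; linarith)
    have h3 := two_mul_hellingerSq_le (p := p) (q := q) hl0 hl1
    have h0 : 0 ≤ hellingerSq p q := by
      rw [hellingerSq_eq]
      exact hellingerDiv_nonneg (by norm_num) (by norm_num)
    have h4 : hellingerSq p q ≤ 3 * hellingerDiv (1 - l) p q := by nlinarith
    have h5 := mul_le_mul_of_nonneg_left h4 (Nat.cast_nonneg (α := ℝ) n)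
    linarith [Real.log_two_gt_d9]

lemma one_div_hellingerDiv_le (hh : hellingerSq p q ≤ 1 / 8) (hα0 : 0 < α)
    (hα1 : α ≤ 1 / 2) (hδ : 0 < δ) (hδα : δ ≤ α / 4)
    (hl : l * Real.log (1 / α) = Real.log 2 / 2) :
    1 / ENNReal.ofReal (hellingerDiv (1 - l) p q) ≤
      (20 : ℝ≥0) * (sampleComplexity p q α δ : ℝ≥0∞) := by
  refine le_mul_sampleComplexity (by norm_num) fun n hn => ENNReal.div_le_of_le_mul ?_
  have := ENNReal.ofReal_le_ofReal (hn.one_le_mul_hellingerDiv hh hα0 hα1 hδ hδα hl)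
  rw [ENNReal.ofReal_one, ENNReal.ofReal_mul (by norm_num), ENNReal.ofReal_mul (by positivity),
    ENNReal.ofReal_natCast, ← mul_assoc] at this
  simpa using this

/-! ### Linear error probability -/

lemma sampleComplexity_le_of_linear (hα0 : 0 < α) (hα1 : α ≤ 1 / 2) (hδα : α / 100 ≤ δ)
    (hl : l * Real.log (1 / α) = Real.log 2 / 2) :
    (sampleComplexity p q α δ : ℝ≥0∞) ≤
      (7 : ℝ≥0) * (1 / ENNReal.ofReal (hellingerDiv (1 - l) p q)) := by
  obtain ⟨hl0, hl1⟩ := tilt_bounds hα0 hα1 hl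
  -- `B = 6` works because `√2 * exp (-6) ≤ exp (-5) ≤ 1/100`.
  have := sampleComplexity_le_div (p := p) (q := q) (α := α) (δ := δ) (s := 1 - l) (B := 6)
    (by linarith) (by linarith) hα0.le (by linarith) (by norm_num) (by
      rw [rpow_one_sub_tilt hα0 _ hl, mul_assoc, ← Real.exp_add]
      refine le_trans ?_ hδα
      rw [div_eq_mul_inv]
      refine mul_le_mul_of_nonneg_left ?_ hα0.le
      have h1 : Real.exp (Real.log 2 / 2 + -6) ≤ Real.exp (-5) :=
        Real.exp_le_exp.2 (by linarith [Real.log_two_lt_d9])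
      refine h1.trans ?_
      rw [Real.exp_neg]
      refine inv_anti₀ (by norm_num) ?_
      have h2 := pow_le_pow_left₀ (by norm_num) Real.exp_one_gt_d9.le 5
      rw [← Real.exp_nat_mul] at h2
      norm_num at h2 ⊢
      linarith)
  refine this.trans_eq ?_
  rw [mul_one_div]
  norm_num

lemma div_infoPerSample_le (hα0 : 0 < α) (hα1 : α ≤ 1 / 2)
    (hl : l * Real.log (1 / α) = Real.log 2 / 2) :
    ENNReal.ofReal (α * Real.log (1 / α)) / infoPerSample α p q ≤
      (3 : ℝ≥0) * (1 / ENNReal.ofReal (hellingerDiv (1 - l) p q)) := by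
  have hL : 0 < Real.log (1 / α) :=
    (Real.log_pos one_lt_two).trans_le (log_two_le_log_inv hα0 hα1)
  have h := le_infoPerSample (p := p) (q := q) hα0 hα1 hl
  have ha0 : ENNReal.ofReal (α * Real.log (1 / α)) ≠ 0 := by
    simpa using mul_pos hα0 hL
  have haT : ENNReal.ofReal (α * Real.log (1 / α)) ≠ ⊤ := ENNReal.ofReal_ne_top
  generalize ENNReal.ofReal (α * Real.log (1 / α)) = a at *
  generalize ENNReal.ofReal (hellingerDiv (1 - l) p q) = H at *
  generalize infoPerSample α p q = I at *
  calc a / I = 3 * a / (3 * I) := (ENNReal.mul_div_mul_left _ _ (by norm_num) (by norm_num)).symm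
    _ ≤ 3 * a / (a * H) := ENNReal.div_le_div_left h _
    _ = a * 3 / (a * H) := by rw [mul_comm]
    _ = 3 / H := ENNReal.mul_div_mul_left _ _ ha0 haT
    _ = _ := by rw [mul_one_div]; rfl

lemma one_div_hellingerDiv_le_div_infoPerSample (hα0 : 0 < α) (hα1 : α ≤ 1 / 2)
    (hl : l * Real.log (1 / α) = Real.log 2 / 2) :
    1 / ENNReal.ofReal (hellingerDiv (1 - l) p q) ≤
      (12 : ℝ≥0) * (ENNReal.ofReal (α * Real.log (1 / α)) / infoPerSample α p q) := by
  have hL : 0 < Real.log (1 / α) :=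
    (Real.log_pos one_lt_two).trans_le (log_two_le_log_inv hα0 hα1)
  have h := infoPerSample_le (p := p) (q := q) hα0 hα1 hl
  have ha0 : ENNReal.ofReal (α * Real.log (1 / α)) ≠ 0 := by
    simpa using mul_pos hα0 hL
  have haT : ENNReal.ofReal (α * Real.log (1 / α)) ≠ ⊤ := ENNReal.ofReal_ne_top
  generalize ENNReal.ofReal (α * Real.log (1 / α)) = a at *
  generalize ENNReal.ofReal (hellingerDiv (1 - l) p q) = H at *
  generalize infoPerSample α p q = I at *
  rw [← mul_assoc] at h
  calc 1 / H = 12 * a * 1 / (12 * a * H) := (ENNReal.mul_div_mul_left _ _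
        (mul_ne_zero (by norm_num) ha0) (ENNReal.mul_ne_top (by norm_num) haT)).symm
    _ ≤ 12 * a * 1 / I := ENNReal.div_le_div_left h _
    _ = _ := by rw [mul_one, mul_div_assoc]; rfl

/-! ### Polynomial error probability -/

lemma sampleComplexity_le_of_polynomial (hα0 : 0 < α) (hα1 : α ≤ 1 / 2) (hδ : 0 < δ)
    (hδα : δ ≤ α / 4) :
    (sampleComplexity p q α δ : ℝ≥0∞) ≤
      (2 : ℝ≥0) * (ENNReal.ofReal (Real.log (1 / δ)) / ENNReal.ofReal (hellingerSq p q)) := by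
  have h1 : 1 ≤ Real.log (1 / δ) := by
    rw [Real.le_log_iff_exp_le (by positivity), le_div_iff₀ hδ]
    nlinarith [Real.exp_one_lt_d9]
  have := sampleComplexity_le_div (p := p) (q := q) (α := α) (δ := δ) (s := 1 / 2)
    (B := Real.log (1 / δ)) (by norm_num) (by norm_num) hα0.le (by linarith) (by linarith) (by
      rw [one_div δ, Real.log_inv, neg_neg, Real.exp_log hδ]
      exact mul_le_of_le_one_left hδ.le (Real.rpow_le_one hα0.le (by linarith) (by norm_num)))
  rw [hellingerSq_eq, ← mul_div_assoc]
  refine this.trans (ENNReal.div_le_div_right ?_ _)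
  rw [show ((2 : ℝ≥0) : ℝ≥0∞) = ENNReal.ofReal 2 by norm_num, ← ENNReal.ofReal_mul (by norm_num)]
  exact ENNReal.ofReal_le_ofReal (by linarith)

lemma half_log_le_log_half (hδ : 0 < δ) (hδα : δ ≤ α / 4) :
    Real.log (α / δ) ≤ 2 * Real.log (α / (2 * δ)) := by
  have hα0 : 0 < α := by linarith
  rw [← Nat.cast_ofNat (R := ℝ), ← Real.log_pow]
  refine Real.log_le_log (by positivity) ?_
  rw [div_pow, div_le_div_iff₀ hδ (by positivity)]
  push_cast
  nlinarith [mul_nonneg (mul_pos hα0 hδ).le (sub_nonneg.2 hδα)]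

lemma div_hellingerSq_le (hh : hellingerSq p q ≤ 1 / 8) (hα0 : 0 < α) (hα1 : α ≤ 1 / 2)
    (hδ : 0 < δ) (hδα : δ ≤ α / 4) (hδα2 : δ ≤ α ^ 2) :
    ENNReal.ofReal (Real.log (1 / δ)) / ENNReal.ofReal (hellingerSq p q) ≤
      (12 : ℝ≥0) * (sampleComplexity p q α δ : ℝ≥0∞) := by
  refine le_mul_sampleComplexity (by norm_num) fun n hn => ENNReal.div_le_of_le_mul ?_
  have h1 := hn.log_le_mul_hellingerSq hh hα0 hα1 hδ
  have h2 := half_log_le_log_half hδ hδα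
  -- Equivalent to `δ ≤ α ^ 2`, the defining condition of the regime.
  have h3 : Real.log (1 / δ) ≤ 2 * Real.log (α / δ) := by
    rw [← Nat.cast_ofNat (R := ℝ), ← Real.log_pow]
    refine Real.log_le_log (by positivity) ?_
    rw [div_pow, div_le_div_iff₀ hδ (by positivity)]
    nlinarith
  have := ENNReal.ofReal_le_ofReal (show Real.log (1 / δ) ≤ 12 * (n * hellingerSq p q) by linarith)
  rw [ENNReal.ofReal_mul (by norm_num), ENNReal.ofReal_mul (by positivity),
    ENNReal.ofReal_natCast, ← mul_assoc] at this
  simpa using this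

/-! ### Sublinear error probability -/

/-- If `k * T` samples beat the error `(α' / 4) ^ T` under the prior `α' ^ T`, then `k` samples
beat the error `α' / 4` under the prior `α'`. -/
lemma SolvableWith.of_pow {α' : ℝ} {T n k : ℕ} (hT : T ≠ 0) (hα0 : 0 < α') (hα1 : α' < 1)
    (hδ : 0 ≤ δ) (hδT : δ ≤ (α' / 4) ^ T) (hk : n ≤ k * T)
    (h : SolvableWith p q (α' ^ T) δ n) : SolvableWith p q α' (α' / 4) k := by
  have hα2 : 0 ≤ 1 - α' := by linarith
  have hp1 : α' ^ T ≤ α' := pow_le_of_le_one hα0.le hα1.le hT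
  rw [solvableWith_iff p q (by positivity) (by linarith) hδ] at h
  rw [solvableWith_iff p q hα0.le hα1.le (by positivity)]
  refine (ENNReal.pow_le_pow_left_iff hT).1 ?_
  calc optError (fun i => p {i}) (fun i => q {i}) k (.ofReal α') (.ofReal (1 - α')) ^ T
      ≤ optError (fun i => p {i}) (fun i => q {i}) (k * T) (.ofReal α' ^ T)
          (.ofReal (1 - α') ^ T) := optError_pow_le _ _ _ _
    _ ≤ optError (fun i => p {i}) (fun i => q {i}) (k * T) (.ofReal (α' ^ T))
          (.ofReal (1 - α' ^ T)) := by
        refine optError_mono _ ?_ ?_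
        · rw [ENNReal.ofReal_pow hα0.le]
        · rw [← ENNReal.ofReal_pow hα2]
          refine ENNReal.ofReal_le_ofReal ((pow_le_of_le_one hα2 (by linarith) hT).trans ?_)
          linarith
    _ ≤ optError (fun i => p {i}) (fun i => q {i}) n (.ofReal (α' ^ T))
          (.ofReal (1 - α' ^ T)) :=
        optError_antitone (tsum_singleton_eq_one p) (tsum_singleton_eq_one q) _ _ hk
    _ ≤ ENNReal.ofReal δ := h
    _ ≤ ENNReal.ofReal ((α' / 4) ^ T) := ENNReal.ofReal_le_ofReal hδT
    _ = ENNReal.ofReal (α' / 4) ^ T := ENNReal.ofReal_pow (by positivity) _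

/-- The number of blocks and the prior of a block when the error probability is sublinear. -/
structure IsBlocking (α δ : ℝ) (T : ℕ) (α' : ℝ) : Prop where
  ne_zero : T ≠ 0
  pos : 0 < α'
  le_eighth : α' ≤ 1 / 8
  pow_eq : α' ^ T = α
  mul_log_le : T * Real.log 8 ≤ Real.log (α / δ)
  le_mul : Real.log (α / δ) ≤ 5 * T
  one_le : 1 ≤ Real.log (α / δ)

lemma isBlocking {T : ℕ} {α' : ℝ} (hα0 : 0 < α) (hδ : 0 < δ) (hδ1 : α ^ 2 ≤ δ)
    (hδ2 : δ ≤ α / 100) (hT : T = ⌊Real.log (α / δ) / Real.log 8⌋₊)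
    (hα' : α' = α ^ (1 / (T : ℝ))) : IsBlocking α δ T α' := by
  have h8 : 0 < Real.log 8 := Real.log_pos (by norm_num)
  have h8e : Real.log 8 = 3 * Real.log 2 := by
    rw [show (8 : ℝ) = 2 ^ 3 by norm_num, Real.log_pow]
    norm_num
  have hD : Real.log 8 ≤ Real.log (α / δ) :=
    Real.log_le_log (by norm_num) (by rw [le_div_iff₀ hδ]; linarith)
  have hT1 : 1 ≤ T := by
    rw [hT]
    exact Nat.le_floor (by rw [Nat.cast_one, le_div_iff₀ h8, one_mul]; exact hD)
  have hT1' : (1 : ℝ) ≤ T := by exact_mod_cast hT1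
  have hT0 : (0 : ℝ) < T := by linarith
  have hTD : T * Real.log 8 ≤ Real.log (α / δ) := by
    rw [← le_div_iff₀ h8, hT]
    exact Nat.floor_le (div_nonneg (h8.le.trans hD) h8.le)
  have hlt : Real.log (α / δ) < (T + 1) * Real.log 8 := by
    rw [← div_lt_iff₀ h8, hT]
    exact Nat.lt_floor_add_one _
  have hpos : 0 < α' := hα' ▸ Real.rpow_pos_of_pos hα0 _
  have hlog : Real.log α' = 1 / T * Real.log α := by rw [hα', Real.log_rpow hα0]
  refine ⟨by omega, hpos, ?_, ?_, hTD, ?_, ?_⟩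
  · rw [← Real.log_le_log_iff hpos (by norm_num), hlog, one_div (8 : ℝ), Real.log_inv,
      one_div_mul_eq_div, div_le_iff₀ hT0]
    -- The condition `α ^ 2 ≤ δ` bounds `T * log 8` by `log (1 / α)`, which keeps the block prior
    -- small.
    have h1 : Real.log (α / δ) ≤ -Real.log α := by
      rw [← Real.log_inv]
      refine Real.log_le_log (by positivity) ?_
      rw [div_le_iff₀ hδ, inv_mul_eq_div, le_div_iff₀ hα0]
      linarith
    linarith
  · rw [hα', ← Real.rpow_natCast, ← Real.rpow_mul hα0.le, one_div_mul_cancel hT0.ne',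
      Real.rpow_one]
  -- Since `T ≥ 1`, `(T + 1) * log 8 ≤ 2 * T * log 8 < 5 * T`.
  · have h2 := Real.log_two_lt_d9
    nlinarith
  · linarith [Real.log_two_gt_d9]

/-- The tilt `l` belongs to `α'`, so for `α` it costs `exp (T * log 2 / 2)`, which is a small power
of `α / δ`. Doubling the exponent `log (α / δ)` absorbs it. -/
lemma sampleComplexity_le_of_sublinear {T : ℕ} {α' : ℝ} (hh : hellingerSq p q ≤ 1 / 8)
    (hα1 : α ≤ 1 / 2) (hδ : 0 < δ) (hb : IsBlocking α δ T α') :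
    (sampleComplexity p q α δ : ℝ≥0∞) ≤ (60 : ℝ≥0) *
      (ENNReal.ofReal (Real.log (α / δ)) * (sampleComplexity p q α' (α' / 4) : ℝ≥0∞)) := by
  have hpos := hb.pos
  have h8 := hb.le_eighth
  have hα0 : 0 < α := hb.pow_eq ▸ pow_pos hpos T
  have hL : 0 < Real.log (1 / α') :=
    (Real.log_pos one_lt_two).trans_le (log_two_le_log_inv hpos (by linarith))
  obtain ⟨l, hl⟩ : ∃ l, l * Real.log (1 / α') = Real.log 2 / 2 :=
    ⟨_, div_mul_cancel₀ _ hL.ne'⟩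
  obtain ⟨hl0, hl1⟩ := tilt_bounds hpos (by linarith) hl
  have h1 := one_div_hellingerDiv_le (p := p) (q := q) hh hpos (by linarith)
    (show 0 < α' / 4 by positivity) le_rfl hl
  have hlT : l * Real.log (1 / α) = T * (Real.log 2 / 2) := by
    rw [← hl, ← hb.pow_eq, one_div, one_div, Real.log_inv, Real.log_inv, Real.log_pow]
    ring
  have h8e : Real.log 8 = 3 * Real.log 2 := by
    rw [show (8 : ℝ) = 2 ^ 3 by norm_num, Real.log_pow]
    norm_num
  have hD := hb.one_le
  have hTD := hb.mul_log_le
  have h2 := sampleComplexity_le_div (p := p) (q := q) (α := α) (δ := δ) (s := 1 - l)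
    (B := 2 * Real.log (α / δ)) (by linarith) (by linarith) hα0.le (by linarith) (by linarith) (by
      rw [rpow_one_sub_tilt hα0 _ hlT, mul_assoc, ← Real.exp_add]
      calc α * Real.exp (T * (Real.log 2 / 2) + -(2 * Real.log (α / δ)))
          ≤ α * Real.exp (-Real.log (α / δ)) := by
            gcongr
            rw [h8e] at hTD
            linarith
        _ = δ := by
            rw [Real.exp_neg, Real.exp_log (by positivity)]
            field_simp)
  calc (sampleComplexity p q α δ : ℝ≥0∞)
      ≤ ENNReal.ofReal (2 * Real.log (α / δ) + 1) / ENNReal.ofReal (hellingerDiv (1 - l) p q) := h2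
    _ ≤ ENNReal.ofReal (3 * Real.log (α / δ)) *
          (1 / ENNReal.ofReal (hellingerDiv (1 - l) p q)) := by
        rw [mul_one_div]
        exact ENNReal.div_le_div_right (ENNReal.ofReal_le_ofReal (by linarith)) _
    _ ≤ ENNReal.ofReal (3 * Real.log (α / δ)) *
          ((20 : ℝ≥0) * (sampleComplexity p q α' (α' / 4) : ℝ≥0∞)) := by gcongr
    _ = _ := by
        rw [ENNReal.ofReal_mul (by norm_num), show ((60 : ℝ≥0) : ℝ≥0∞) = ENNReal.ofReal 3 * 20 by
          norm_num]
        push_cast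
        ring

lemma log_mul_sampleComplexity_le {T : ℕ} {α' : ℝ} (hh : hellingerSq p q ≤ 1 / 8)
    (hα1 : α ≤ 1 / 2) (hδ : 0 < δ) (hδα : δ ≤ α / 4) (hb : IsBlocking α δ T α') :
    ENNReal.ofReal (Real.log (α / δ)) * (sampleComplexity p q α' (α' / 4) : ℝ≥0∞) ≤
      (6 : ℝ≥0) * (sampleComplexity p q α δ : ℝ≥0∞) := by
  have hpos := hb.pos
  have h8 := hb.le_eighth
  have hα0 : 0 < α := by linarith
  refine le_mul_sampleComplexity (by norm_num) fun n hn => ?_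
  have hT0 : (0 : ℝ) < T := by exact_mod_cast Nat.pos_of_ne_zero hb.ne_zero
  have hδT : δ ≤ (α' / 4) ^ T := by
    rw [div_pow, hb.pow_eq, le_div_iff₀ (by positivity), mul_comm, ← le_div_iff₀ hδ,
      ← Real.log_le_log_iff (by positivity) (by positivity), Real.log_pow]
    refine le_trans ?_ hb.mul_log_le
    gcongr
    norm_num
  -- `n / T` is natural-number division; adding one ensures that the `T` blocks cover all `n`
  -- samples.
  have hs : SolvableWith p q α' (α' / 4) (n / T + 1) :=
    SolvableWith.of_pow hb.ne_zero hpos (by linarith) hδ.le hδT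
      (by rw [mul_comm]; exact (Nat.lt_mul_div_succ n (Nat.pos_of_ne_zero hb.ne_zero)).le)
      (hb.pow_eq.symm ▸ hn)
  have h1 := hn.log_le_mul_hellingerSq hh hα0 hα1 hδ
  have h2 := half_log_le_log_half hδ hδα
  have h3 := hb.one_le
  have h4 := hb.le_mul
  have hn0 : (0 : ℝ) ≤ n := Nat.cast_nonneg n
  -- The extra sample per block is affordable: the bound through `h² ≤ 1/8` already forces `n ≥ log
  -- (α / δ)`.
  have h5 : Real.log (α / δ) ≤ n := by nlinarith
  have h6 : Real.log (α / δ) * ((n / T + 1 : ℕ) : ℝ) ≤ 6 * n := by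
    have h7 : (((n / T : ℕ) : ℝ)) ≤ n / T := Nat.cast_div_le
    push_cast
    calc Real.log (α / δ) * (((n / T : ℕ) : ℝ) + 1)
        ≤ Real.log (α / δ) * ((n : ℝ) / T + 1) := by gcongr
      _ = Real.log (α / δ) * (n / T) + Real.log (α / δ) := by ring
      _ ≤ 5 * T * (n / T) + n := by gcongr
      _ = 6 * n := by field_simp; ring
  calc ENNReal.ofReal (Real.log (α / δ)) * (sampleComplexity p q α' (α' / 4) : ℝ≥0∞)
      ≤ ENNReal.ofReal (Real.log (α / δ)) * (((n / T + 1 : ℕ) : ℕ∞) : ℝ≥0∞) := by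
        gcongr
        exact sampleComplexity_le hs
    _ = ENNReal.ofReal (Real.log (α / δ) * ((n / T + 1 : ℕ) : ℝ)) := by
        rw [ENNReal.ofReal_mul (by linarith), ENNReal.ofReal_natCast, ENat.toENNReal_coe]
    _ ≤ ENNReal.ofReal (6 * n) := ENNReal.ofReal_le_ofReal h6
    _ = (6 : ℝ≥0) * n := by rw [ENNReal.ofReal_mul (by norm_num)]; simp

end Bounds

lemma EqUpTo.of_le {C₁ C₂ C : ℝ≥0} {a b : ℝ≥0∞} (h₁ : a ≤ C₁ * b) (h₂ : b ≤ C₂ * a)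
    (hC₁ : C₁ ≤ C) (hC₂ : C₂ ≤ C) : EqUpTo C a b :=
  ⟨h₁.trans (by gcongr), h₂.trans (by gcongr)⟩

lemma le_mul_of_le_mul_of_le_mul {C₁ C₂ : ℝ≥0} {a b c : ℝ≥0∞} (h₁ : a ≤ C₁ * b)
    (h₂ : b ≤ C₂ * c) : a ≤ (C₁ * C₂ : ℝ≥0) * c := by
  refine h₁.trans ?_
  rw [ENNReal.coe_mul, mul_assoc]
  gcongr

end HypothesisTesting

theorem theorem1 :
    ∃ C : ℝ≥0, 0 < C ∧
      ∀ (𝒳 : Type*) [Countable 𝒳] [MeasurableSpace 𝒳] [MeasurableSingletonClass 𝒳]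
        (p q : Measure 𝒳) [IsProbabilityMeasure p] [IsProbabilityMeasure q] (α δ : ℝ),
        hellingerSq p q ≤ 0.125 →
        0 < α → α ≤ 1 / 2 → 0 < δ → δ ≤ α / 4 →
        -- linear error probability
        (α / 100 ≤ δ →
          ∀ l : ℝ, l = 0.5 * Real.log 2 / Real.log (1 / α) →
            EqUpTo C (sampleComplexity p q α δ)
              (ENNReal.ofReal (α * Real.log (1 / α)) / infoPerSample α p q) ∧
            EqUpTo C (ENNReal.ofReal (α * Real.log (1 / α)) / infoPerSample α p q)
              (1 / ENNReal.ofReal (hellingerDiv (1 - l) p q))) ∧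
        -- sublinear error probability
        (α ^ 2 ≤ δ → δ ≤ α / 100 →
          ∀ (T : ℕ) (α' : ℝ), T = ⌊Real.log (α / δ) / Real.log 8⌋₊ → α' = α ^ (1 / (T : ℝ)) →
            EqUpTo C (sampleComplexity p q α δ)
              (ENNReal.ofReal (Real.log (α / δ)) * (sampleComplexity p q α' (α' / 4) : ℝ≥0∞))) ∧
        -- polynomial error probability
        (δ ≤ α ^ 2 →
          EqUpTo C (sampleComplexity p q α δ)
            (ENNReal.ofReal (Real.log (1 / δ)) / ENNReal.ofReal (hellingerSq p q))) := by
  -- The largest constant needed is `7 * 12 = 84`, from chaining two bounds in the linear regime.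
  refine ⟨100, by norm_num, ?_⟩
  intro 𝒳 _ _ _ p q _ _ α δ hh hα0 hα1 hδ0 hδα
  have hh' : hellingerSq p q ≤ 1 / 8 := hh.trans (by norm_num)
  refine ⟨fun hlin l hl => ?_, fun hδ1 hδ2 T α' hT hα' => ?_, fun hδ2 => ?_⟩
  · have hL : 0 < Real.log (1 / α) :=
      (Real.log_pos one_lt_two).trans_le (log_two_le_log_inv hα0 hα1)
    have hl' : l * Real.log (1 / α) = Real.log 2 / 2 := by
      rw [hl, div_mul_cancel₀ _ hL.ne']
      ring
    have h1 := one_div_hellingerDiv_le (p := p) (q := q) hh' hα0 hα1 hδ0 hδα hl'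
    have h2 := sampleComplexity_le_of_linear (p := p) (q := q) hα0 hα1 hlin hl'
    have h3 := div_infoPerSample_le (p := p) (q := q) hα0 hα1 hl'
    have h4 := one_div_hellingerDiv_le_div_infoPerSample (p := p) (q := q) hα0 hα1 hl'
    exact ⟨.of_le (le_mul_of_le_mul_of_le_mul h2 h4) (le_mul_of_le_mul_of_le_mul h3 h1)
      (by norm_num) (by norm_num), .of_le h3 h4 (by norm_num) (by norm_num)⟩
  · have hb := isBlocking hα0 hδ0 hδ1 hδ2 hT hα'
    exact .of_le (sampleComplexity_le_of_sublinear hh' hα1 hδ0 hb)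
      (log_mul_sampleComplexity_le hh' hα1 hδ0 hδα hb) (by norm_num) (by norm_num)
  · exact .of_le (sampleComplexity_le_of_polynomial hα0 hα1 hδ0 hδα)
      (div_hellingerSq_le hh' hα0 hα1 hδ0 hδα hδ2) (by norm_num) (by norm_num)
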